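/- Let $Q$ be a finite-dimensional smooth manifold, $k$ a natural number, and $g_1,\dots,g_k$ semi-Riemannian metrics on $Q$, with dual metrics $g_A^*$ on covectors. Let $V\in C^\infty(\mathbb R^k\times Q)$. On $\mathbb R^k\times (T^1_k)^*Q$, where $(T^1_k)^*Q=T^*Q\oplus\overset{k}{\cdots}\oplus T^*Q$, consider the forms $\eta^A=dt^A$ and $\omega^A=-d\theta^A$, where $\theta^A$ is the pullback of the Liouville $1$-form of $T^*Q$ by $(t,q;\alpha^1_q,\dots,\alpha^k_q)\mapsto\alpha^A_q$, so that locally $\theta^A=\sum_i p^A_i\,dq^i$ and $\omega^A=\sum_i dq^i\wedge dp^A_i$. Consider also the quadratic Hamiltonian $$H(t,q;\alpha^1_q,\dots,\alpha^k_q)=\tfrac12\sum_{A=1}^k g_A^*(\alpha^A_q,\alpha^A_q)+V(t,q).$$ Let $X$ be a smooth vector field on $Q$ with $L_Xg_A=0$ for all $A$ and $X(V)=0$, where $X$ is regarded as the vector field $(0,X)$ on $\mathbb R^k\times Q$. Let $X^{1*}=X^i\frac{\partial}{\partial q^i}-p^A_j\frac{\partial X^j}{\partial q^i}\frac{\partial}{\partial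 p^A_i}$. Then: 1. $X^{1*}$ is the complete lift of $X$: it is the infinitesimal generator of the canonical prolongations $j^{1*}\varphi_s$ of the local flows $\varphi_s$ of $(0,X)$. Here, if a local diffeomorphism $\varphi$ of $\mathbb R^k\times Q$ is fibred over a local diffeomorphism $\varphi_Q$ of $Q$, its prolongation is $(j^{1*}\varphi)(j^1_q\sigma)=j^1_{\varphi_Q(q)}(\varphi\circ\sigma\circ\varphi_Q^{-1})$, where $(t,q;\alpha^1_q,\dots,\alpha^k_q)$ is identified with the $1$-jet at $q$ of a section $\sigma$ of $\mathbb R^k\times Q\to Q$ whose $\mathbb R^k$-component has value $t$ and differential $(\alpha^1_q,\dots,\alpha^k_q)$ at $q$. 2. $X^{1*}$ is a natural infinitesimal $k$-cosymplectic Noether symmetry of $H$. That is, it is a smooth vector field on $\mathbb R^k\times (T^1_k)^*Q$ with $L_{X^{1*}}\omega^A=0$ and $i_{X^{1*}}\eta^A=0$ for all $A$ and $L_{X^{1*}}H=0$, and it is the complete lift of a smooth vector field on $\mathbb R^k\times Q$ that is projectable to $Q$. 3. The map $\mathcal F(t,q;\alpha^1_q,\dots,\alpha^k_q)=(\alpha^1_q(X(q)),\dots,\alpha^k_q(X(q)))$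 is a conservation law. That is, $\mathcal F$ is smooth, and for every open $U\subseteq\mathbb R^k$ and every smooth section $\psi:U\to\mathbb R^k\times (T^1_k)^*Q$ of the projection to $\mathbb R^k$ that solves the Hamilton–de Donder–Weyl equations $$\sum_{A=1}^k i\big(\psi_*(t)(\partial/\partial t^A|_t)\big)\,\omega^A=dH-\sum_{A=1}^k\frac{\partial H}{\partial t^A}\,\eta^A\quad\text{along }\psi,$$ one has $\sum_{A=1}^k\frac{\partial(\mathcal F^A\circ\psi)}{\partial t^A}=0$ on $U$. -/

import Mathlib

open Bundle VectorField
open scoped Manifold ContDiff Topology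

noncomputable section

namespace KCosymplectic

/-! ### Calculus on a manifold `M` -/

section Manifold

variable {EM : Type*} [NormedAddCommGroup EM] [NormedSpace ℝ EM]
  {HM : Type*} [TopologicalSpace HM] (I : ModelWithCorners ℝ EM HM)
  {M : Type*} [TopologicalSpace M] [ChartedSpace HM M] [IsManifold I 1 M]

/-- The vector field `X` is smooth at the point `x`. -/
def SmoothFieldAt (X : Π x : M, TangentSpace I x) (x : M) : Prop :=
  ContMDiffAt I I.tangent ∞ (fun y => (⟨y, X y⟩ : TangentBundle I M)) x

/-- The vector field `X` is smooth on `M`. -/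
def SmoothField (X : Π x : M, TangentSpace I x) : Prop :=
  ∀ x, SmoothFieldAt I X x

/-- The value `(L_Y T)(Z, W)` at `x` of the Lie derivative of a covariant 2-tensor field `T`, that
is `Y(T(Z, W)) - T([Y, Z], W) - T(Z, [Y, W])`. -/
def lieDerivTwo (Y : Π x : M, TangentSpace I x)
    (T : Π x : M, TangentSpace I x →L[ℝ] TangentSpace I x →L[ℝ] ℝ)
    (Z W : Π x : M, TangentSpace I x) (x : M) : ℝ :=
  mvfderiv I (fun y => T y (Z y) (W y)) x (Y x)
    - T x (mlieBracket I Y Z x) (W x) - T x (Z x) (mlieBracket I Y W x)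

/-- `L_Y T = 0` for a covariant 2-tensor field `T`. -/
def LieDerivTwoEqZero (Y : Π x : M, TangentSpace I x)
    (T : Π x : M, TangentSpace I x →L[ℝ] TangentSpace I x →L[ℝ] ℝ) : Prop :=
  ∀ (x : M) (Z W : Π x : M, TangentSpace I x), SmoothFieldAt I Z x → SmoothFieldAt I W x →
    lieDerivTwo I Y T Z W x = 0

/-- The expression of a 1-form `θ` in the preferred chart at `x`. -/
def oneFormInChart (θ : Π x : M, TangentSpace I x →L[ℝ] ℝ) (x : M) : EM → (EM →L[ℝ] ℝ) :=
  fun y => (θ ((extChartAt I x).symm y)).comp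
    (mfderiv 𝓘(ℝ, EM) I (extChartAt I x).symm y)

/-- The exterior derivative of a 1-form on a manifold without boundary, computed at `x` in the
preferred chart at `x` (each tangent space is, by definition, a copy of the model space): there `(dθ)(v, w) = (D_v θ)(w) - (D_w θ)(v)`. -/
def extDerivOne (θ : Π x : M, TangentSpace I x →L[ℝ] ℝ) (x : M) :
    TangentSpace I x →L[ℝ] TangentSpace I x →L[ℝ] ℝ :=
  let D : EM →L[ℝ] EM →L[ℝ] ℝ := fderiv ℝ (oneFormInChart I θ x) (extChartAt I x x)
  let c : EM →L[ℝ] EM := mfderiv I 𝓘(ℝ, EM) (extChartAt I x) x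
  show EM →L[ℝ] EM →L[ℝ] ℝ from (D - D.flip).bilinearComp c c

/-- The expression of a vector field in the preferred chart at `x`. -/
def fieldInChart (X : Π x : M, TangentSpace I x) (x : M) : EM → EM :=
  fun y => mfderiv I 𝓘(ℝ, EM) (extChartAt I x) ((extChartAt I x).symm y)
    (X ((extChartAt I x).symm y))

/-- `φ` is a smooth local flow (local 1-parameter group) of the vector field `Z` around the
point `p`, for small times. -/
structure IsLocalFlow (Z : Π x : M, TangentSpace I x) (p : M) (φ : ℝ → M → M) : Prop where
  smooth : ContMDiffAt (𝓘(ℝ, ℝ).prod I) I ∞ (fun z : ℝ × M => φ z.1 z.2) (0, p)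
  zero : ∀ᶠ y in 𝓝 p, φ 0 y = y
  deriv : ∀ᶠ z : ℝ × M in 𝓝 (0, p),
    HasMFDerivAt 𝓘(ℝ, ℝ) I (fun s => φ s z.2) z.1
      ((1 : ℝ →L[ℝ] ℝ).smulRight (Z (φ z.1 z.2)))

end Manifold

/-! ### Semi-Riemannian metrics -/

section Metric

variable (E : Type*) [NormedAddCommGroup E] [NormedSpace ℝ E]
  (Q : Type*) [TopologicalSpace Q] [ChartedSpace E Q] [IsManifold 𝓘(ℝ, E) ∞ Q]

/-- A semi-Riemannian metric: a smooth symmetric nondegenerate covariant 2-tensor field. Its index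
is automatically locally constant, and is not required to agree on different components. -/
structure SemiRiemannianMetric where
  val (q : Q) : TangentSpace 𝓘(ℝ, E) q →L[ℝ] TangentSpace 𝓘(ℝ, E) q →L[ℝ] ℝ
  symm (q : Q) (v w : TangentSpace 𝓘(ℝ, E) q) : val q v w = val q w v
  nondegenerate (q : Q) (v : TangentSpace 𝓘(ℝ, E) q) (hv : ∀ w, val q v w = 0) : v = 0
  contMDiff : ContMDiff 𝓘(ℝ, E) (𝓘(ℝ, E).prod 𝓘(ℝ, E →L[ℝ] E →L[ℝ] ℝ)) ∞
    (fun q => TotalSpace.mk' (E →L[ℝ] E →L[ℝ] ℝ)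
      (E := fun q : Q => TangentSpace 𝓘(ℝ, E) q →L[ℝ] TangentSpace 𝓘(ℝ, E) q →L[ℝ] ℝ)
      q (val q))

variable {E Q} [FiniteDimensional ℝ E]

/-- The isomorphism `g♭ : T_q Q → T_q^* Q`, `v ↦ g(v, ·)`. -/
def SemiRiemannianMetric.flat (g : SemiRiemannianMetric E Q) (q : Q) :
    TangentSpace 𝓘(ℝ, E) q ≃ₗ[ℝ] (TangentSpace 𝓘(ℝ, E) q →L[ℝ] ℝ) :=
  haveI : FiniteDimensional ℝ (TangentSpace 𝓘(ℝ, E) q) := inferInstanceAs (FiniteDimensional ℝ E)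
  LinearEquiv.ofInjectiveOfFinrankEq (g.val q).toLinearMap
    ((injective_iff_map_eq_zero _).2 fun v hv =>
      g.nondegenerate q v fun w => DFunLike.congr_fun hv w)
    (by
      change Module.finrank ℝ E = Module.finrank ℝ (E →L[ℝ] ℝ)
      rw [← LinearEquiv.finrank_eq
        (LinearMap.toContinuousLinearMap : (E →ₗ[ℝ] ℝ) ≃ₗ[ℝ] (E →L[ℝ] ℝ))]
      exact Subspace.dual_finrank_eq.symm)

/-- The dual metric `g^*(α, β) = g((g♭)⁻¹ α, (g♭)⁻¹ β)` on covectors at `q`. -/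
def SemiRiemannianMetric.dual (g : SemiRiemannianMetric E Q) (q : Q)
    (α β : TangentSpace 𝓘(ℝ, E) q →L[ℝ] ℝ) : ℝ :=
  g.val q ((g.flat q).symm α) ((g.flat q).symm β)

end Metric

/-! ### The phase space `ℝ^k × (T^1_k)^* Q` and its canonical forms -/

section PhaseSpace

variable (k : ℕ) (E : Type*) [NormedAddCommGroup E] [NormedSpace ℝ E]
  (Q : Type*) [TopologicalSpace Q] [ChartedSpace E Q] [IsManifold 𝓘(ℝ, E) ∞ Q]

/-- The bundle of `k^1`-covelocities `(T^1_k)^* Q = T^*Q ⊕ ⋯ ⊕ T^*Q = J^1(Q, ℝ^k)_0`, realised as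
the vector bundle `Hom(TQ, ℝ^k)`: an element over `q` is a linear map `T_q Q → ℝ^k`, whose `k`
components are the covectors `α^1, …, α^k` at `q`. -/
abbrev Covelocities : Type _ :=
  TotalSpace (E →L[ℝ] (Fin k → ℝ))
    (fun q : Q => TangentSpace 𝓘(ℝ, E) q →L[ℝ] Trivial Q (Fin k → ℝ) q)

/-- The phase space `ℝ^k × (T^1_k)^* Q`, with points `x = (t, ⟨q, α⟩)`. -/
abbrev PhaseSpace : Type _ := (Fin k → ℝ) × Covelocities k E Q

/-- The model with corners of the manifold `ℝ^k × (T^1_k)^* Q`. Its preferred charts are the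
natural coordinates `(t^A, q^i, p^A_i)` induced by the preferred charts of `Q`. -/
abbrev phaseModel : ModelWithCorners ℝ ((Fin k → ℝ) × E × (E →L[ℝ] (Fin k → ℝ)))
    (ModelProd (Fin k → ℝ) (ModelProd E (E →L[ℝ] (Fin k → ℝ)))) :=
  𝓘(ℝ, Fin k → ℝ).prod (𝓘(ℝ, E).prod 𝓘(ℝ, E →L[ℝ] (Fin k → ℝ)))

/-- The model with corners of the manifold `ℝ^k × Q`. -/
abbrev configModel : ModelWithCorners ℝ ((Fin k → ℝ) × E) (ModelProd (Fin k → ℝ) E) :=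
  𝓘(ℝ, Fin k → ℝ).prod 𝓘(ℝ, E)

variable {k E Q}

/-- The covector `α^A` at `q` of the point `x = (t, q; α^1, …, α^k)`. -/
def covector (x : PhaseSpace k E Q) (A : Fin k) : TangentSpace 𝓘(ℝ, E) x.2.proj →L[ℝ] ℝ :=
  (ContinuousLinearMap.proj (R := ℝ) (φ := fun _ : Fin k => ℝ) A).comp x.2.snd

/-- `η^A = d t^A`. -/
def etaForm (A : Fin k) (x : PhaseSpace k E Q) : TangentSpace (phaseModel k E) x →L[ℝ] ℝ :=
  mvfderiv (phaseModel k E) (fun y : PhaseSpace k E Q => y.1 A) x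

/-- The canonical 1-form `θ^A`, the pullback of the Liouville form by
`(t; α^1, …, α^k) ↦ α^A`: it sends `v` to `α^A(T(π_Q)_1 v)`. -/
def thetaForm (A : Fin k) (x : PhaseSpace k E Q) : TangentSpace (phaseModel k E) x →L[ℝ] ℝ :=
  (covector x A).comp
    (mfderiv (phaseModel k E) 𝓘(ℝ, E) (fun y : PhaseSpace k E Q => y.2.proj) x)

/-- The canonical 2-form `ω^A = -dθ^A`. -/
def omegaForm (A : Fin k) (x : PhaseSpace k E Q) :
    TangentSpace (phaseModel k E) x →L[ℝ] TangentSpace (phaseModel k E) x →L[ℝ] ℝ :=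
  -extDerivOne (phaseModel k E) (thetaForm A) x

/-- The Reeb vector field `R_A = ∂/∂t^A`. -/
def reeb (A : Fin k) (x : PhaseSpace k E Q) : TangentSpace (phaseModel k E) x :=
  mfderiv 𝓘(ℝ, Fin k → ℝ) (phaseModel k E)
    (fun t : Fin k → ℝ => ((t, x.2) : PhaseSpace k E Q)) x.1 (Pi.single A (1 : ℝ) : Fin k → ℝ)

/-! ### Hamilton-de Donder-Weyl equations and conservation laws -/

/-- `ψ : U ⊆ ℝ^k → ℝ^k × (T^1_k)^* Q` is a smooth section of the projection to `ℝ^k` that solves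
the Hamilton-de Donder-Weyl equations
`∑_A i(ψ_*(t)(∂/∂t^A)) ω^A = dH - ∑_A R_A(H) η^A` along `ψ`. -/
structure IsHDWSolution (H : PhaseSpace k E Q → ℝ) (U : Set (Fin k → ℝ))
    (ψ : (Fin k → ℝ) → PhaseSpace k E Q) : Prop where
  isOpen : IsOpen U
  smooth : ContMDiffOn 𝓘(ℝ, Fin k → ℝ) (phaseModel k E) ∞ ψ U
  isSection : ∀ t ∈ U, (ψ t).1 = t
  equation : ∀ t ∈ U, ∀ w : TangentSpace (phaseModel k E) (ψ t),
    ∑ A, omegaForm A (ψ t)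
        (mfderiv 𝓘(ℝ, Fin k → ℝ) (phaseModel k E) ψ t (Pi.single A (1 : ℝ) : Fin k → ℝ)) w
      = mvfderiv (phaseModel k E) H (ψ t) w
        - ∑ A, mvfderiv (phaseModel k E) H (ψ t) (reeb A (ψ t)) * etaForm A (ψ t) w

/-- The smooth map `F = (F^1, …, F^k)` is a conservation law: the divergence of `F ∘ ψ` vanishes for
every solution `ψ` of the Hamilton-de Donder-Weyl equations. -/
def IsConservationLaw (H : PhaseSpace k E Q → ℝ) (F : PhaseSpace k E Q → (Fin k → ℝ)) : Prop :=
  ContMDiff (phaseModel k E) 𝓘(ℝ, Fin k → ℝ) ∞ F ∧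
    ∀ (U : Set (Fin k → ℝ)) (ψ : (Fin k → ℝ) → PhaseSpace k E Q), IsHDWSolution H U ψ →
      ∀ t ∈ U, ∑ A, fderiv ℝ (fun s => F (ψ s) A) t (Pi.single A 1) = 0

/-! ### Prolongations and complete lifts -/

/-- The canonical prolongation `j^{1*}φ` of a bundle diffeomorphism `φ` of `ℝ^k × Q → Q` (which may
be only locally defined, around the base point considered),
`(j^{1*}φ)(j^1_q σ) = j^1_{φ_Q(q)}(φ ∘ σ ∘ φ_Q⁻¹)`. At `(t, q, α)`, where `α` is the differential
at `q` of the `ℝ^k`-part of `σ`, the new linear map is `(d_q φ^t + d_t φ^t ∘ α) ∘ (T_q φ_Q)⁻¹`,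
with `φ^t` the `ℝ^k`-component of `φ`. -/
def prolong (φ : (Fin k → ℝ) × Q → (Fin k → ℝ) × Q) (x : PhaseSpace k E Q) : PhaseSpace k E Q :=
  let t : Fin k → ℝ := x.1
  let q : Q := x.2.proj
  let α : TangentSpace 𝓘(ℝ, E) q →L[ℝ] (Fin k → ℝ) := x.2.snd
  let dq : TangentSpace 𝓘(ℝ, E) q →L[ℝ] (Fin k → ℝ) :=
    mvfderiv 𝓘(ℝ, E) (fun q' => (φ (t, q')).1) q
  let dt : (Fin k → ℝ) →L[ℝ] (Fin k → ℝ) := fderiv ℝ (fun t' => (φ (t', q)).1) t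
  let T : TangentSpace 𝓘(ℝ, E) q →L[ℝ] TangentSpace 𝓘(ℝ, E) (φ (t, q)).2 :=
    mfderiv 𝓘(ℝ, E) 𝓘(ℝ, E) (fun q' => (φ (t, q')).2) q
  ((φ (t, q)).1, ⟨(φ (t, q)).2, (dq + dt.comp α).comp T.inverse⟩)

/-- A vector field on `ℝ^k × Q` is `π_Q`-projectable, where `π_Q(t, q) = q`. -/
def IsProjectable (Z : Π p : (Fin k → ℝ) × Q, TangentSpace (configModel k E) p) : Prop :=
  ∃ X : Π q : Q, TangentSpace 𝓘(ℝ, E) q, ∀ p : (Fin k → ℝ) × Q,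
    mfderiv (configModel k E) 𝓘(ℝ, E) (Prod.snd : (Fin k → ℝ) × Q → Q) p (Z p) = X p.2

/-- `Y` is the complete lift `Z^{1*}`: it is the infinitesimal generator of the prolongations
`j^{1*}φ_s` of the local flows `φ_s` of `Z`. -/
def IsCompleteLift (Z : Π p : (Fin k → ℝ) × Q, TangentSpace (configModel k E) p)
    (Y : Π x : PhaseSpace k E Q, TangentSpace (phaseModel k E) x) : Prop :=
  ∀ (x : PhaseSpace k E Q) (φ : ℝ → (Fin k → ℝ) × Q → (Fin k → ℝ) × Q),
    IsLocalFlow (configModel k E) Z (x.1, x.2.proj) φ →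
      HasMFDerivAt 𝓘(ℝ, ℝ) (phaseModel k E) (fun s => prolong (E := E) (φ s) x) 0
        ((1 : ℝ →L[ℝ] ℝ).smulRight (Y (prolong (E := E) (φ 0) x)))

/-- A vector field `X` on `Q`, regarded as the vector field `(0, X)` on `ℝ^k × Q`. -/
def extendField (X : Π q : Q, TangentSpace 𝓘(ℝ, E) q) (p : (Fin k → ℝ) × Q) :
    TangentSpace (configModel k E) p :=
  mfderiv 𝓘(ℝ, E) (configModel k E) (fun q => (p.1, q)) p.2 (X p.2)

/-- The vector field `X^{1*}` on `ℝ^k × (T^1_k)^* Q`, given in natural coordinates by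
`X^i ∂/∂q^i - p^A_j (∂X^j/∂q^i) ∂/∂p^A_i`. -/
def completeLift (X : Π q : Q, TangentSpace 𝓘(ℝ, E) q) (x : PhaseSpace k E Q) :
    TangentSpace (phaseModel k E) x :=
  let c : (Fin k → ℝ) × E × (E →L[ℝ] (Fin k → ℝ)) := extChartAt (phaseModel k E) x x
  let X' : E → E := fieldInChart 𝓘(ℝ, E) X x.2.proj
  let v : (Fin k → ℝ) × E × (E →L[ℝ] (Fin k → ℝ)) :=
    (0, X' c.2.1, -(c.2.2.comp (fderiv ℝ X' c.2.1)))
  mfderiv 𝓘(ℝ, (Fin k → ℝ) × E × (E →L[ℝ] (Fin k → ℝ))) (phaseModel k E)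
    (extChartAt (phaseModel k E) x).symm c v

/-! ### Noether symmetries and quadratic Hamiltonians -/

/-- Infinitesimal `k`-cosymplectic Noether symmetries: smooth vector fields `Y` with `L_Y ω^A = 0`,
`i_Y η^A = 0` and `L_Y H = 0`. -/
structure IsInfinitesimalNoetherSymmetry (H : PhaseSpace k E Q → ℝ)
    (Y : Π x : PhaseSpace k E Q, TangentSpace (phaseModel k E) x) : Prop where
  smooth : SmoothField (phaseModel k E) Y
  omega : ∀ A : Fin k, LieDerivTwoEqZero (phaseModel k E) Y (omegaForm A)
  eta : ∀ (A : Fin k) (x : PhaseSpace k E Q), etaForm A x (Y x) = 0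
  hamiltonian : ∀ x : PhaseSpace k E Q, mvfderiv (phaseModel k E) H x (Y x) = 0

/-- An infinitesimal Noether symmetry is natural if it is the complete lift of a (smooth,
`π_Q`-projectable) vector field on `ℝ^k × Q`. -/
def IsNaturalInfinitesimalNoetherSymmetry (H : PhaseSpace k E Q → ℝ)
    (Y : Π x : PhaseSpace k E Q, TangentSpace (phaseModel k E) x) : Prop :=
  IsInfinitesimalNoetherSymmetry H Y ∧
    ∃ Z : Π p : (Fin k → ℝ) × Q, TangentSpace (configModel k E) p,
      SmoothField (configModel k E) Z ∧ IsProjectable Z ∧ IsCompleteLift Z Y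

/-- The quadratic Hamiltonian `H(t, q; α) = ½ ∑_A g_A^*(α^A, α^A) + V(t, q)`. -/
def quadraticHamiltonian [FiniteDimensional ℝ E] (g : Fin k → SemiRiemannianMetric E Q)
    (V : (Fin k → ℝ) × Q → ℝ) (x : PhaseSpace k E Q) : ℝ :=
  (1 / 2) * ∑ A, (g A).dual x.2.proj (covector x A) (covector x A) + V (x.1, x.2.proj)

end PhaseSpace

end KCosymplectic

end

/-! Everything is computed in natural coordinates `(t, u, p)`, with `p : E →L[ℝ] ℝ^k`. Write `X` for
the expression of the field in a chart of `Q`. The lift is then `Y = (0, X, -p ∘ DX)` and `ω^A(v, w)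
= w_p(v_u)^A - v_p(w_u)^A`. These formulas hold in every natural chart, not only at its centre: a
change of chart produces extra terms in the Hessian of the transition map, and these cancel because
that Hessian is symmetric (`dChart_phase`, `fieldInChart_completeLift`, `omegaForm_chart`).

Generator of prolongations: the derivative of a flow `φ_s` in space starts at the identity and
changes at rate `DX`, by equality of mixed partials. The prolongation carries `p` to `p` composed
with the inverse of that derivative, so its velocity is `-p ∘ DX`
(`hasDerivAt_fderiv_of_hasDerivAt`, `hasDerivAt_prolong_coord`).

Symmetry: `ω^A` has constant coefficients, so `L_Y ω^A` involves only `DY`. Its terms in `DX` cancel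
in pairs, and those in `D²X` by symmetry. `Y` has no time component, hence `i_Y η^A = 0`. For `H`,
let `G` be the matrix of `g_A` and `S = G⁻¹ p^A`. Differentiating `G S = p^A` along `Y` and using
the Killing equation shows that `p^A(S)` is constant along `Y` (`fderiv_inverse_quadratic_eq_zero`).
The potential is invariant because `X(V) = 0`.

Conservation law: `dF^A = i_Y ω^A` for `F^A = α^A(X)`. Contracting the field equations with `Y`
makes the left side minus the divergence of `F ∘ ψ`, while the right side is `Y(H)` minus terms in
`η^A(Y)`, that is, zero (`isConservationLaw_of_completeLift`). -/

noncomputable section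

namespace KCosymplectic

/-! ### Vector fields, brackets and tensors read in preferred charts -/

section ChartCalculus

variable {EM : Type*} [NormedAddCommGroup EM] [NormedSpace ℝ EM]
  {HM : Type*} [TopologicalSpace HM] (I : ModelWithCorners ℝ EM HM)
  {M : Type*} [TopologicalSpace M] [ChartedSpace HM M]

/-- The derivative at `y` of the preferred chart at `x`, as an endomorphism of the model space. -/
def dChart (x y : M) : EM →L[ℝ] EM := mfderiv I 𝓘(ℝ, EM) (extChartAt I x) y

/-- The derivative at `u` of the inverse of the preferred chart at `x`. -/
def dChartSymm (x : M) (u : EM) : EM →L[ℝ] EM := mfderiv 𝓘(ℝ, EM) I (extChartAt I x).symm u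

/-- The tangent space at `x` is the model space as read through the preferred chart at `x`. This is
what allows tangent vectors to be written as tuples of coordinates below. -/
lemma dChart_self [IsManifold I 1 M] (x : M) : dChart I x x = ContinuousLinearMap.id ℝ EM :=
  mfderiv_extChartAt_self

lemma extDerivOne_apply [IsManifold I 1 M] (θ : Π x : M, TangentSpace I x →L[ℝ] ℝ) (x : M)
    (v w : EM) :
    extDerivOne I θ x v w = fderiv ℝ (oneFormInChart I θ x) (extChartAt I x x) v w
      - fderiv ℝ (oneFormInChart I θ x) (extChartAt I x x) w v := by
  have h : extDerivOne I θ x v w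
      = fderiv ℝ (oneFormInChart I θ x) (extChartAt I x x) (dChart I x x v) (dChart I x x w)
      - fderiv ℝ (oneFormInChart I θ x) (extChartAt I x x) (dChart I x x w) (dChart I x x v) := rfl
  rw [h, dChart_self]
  rfl

lemma dChartSymm_self [IsManifold I 1 M] [I.Boundaryless] (x : M) :
    dChartSymm I x (extChartAt I x x) = ContinuousLinearMap.id ℝ EM := by
  have := mfderivWithin_range_extChartAt_symm (I := I) (x := x)
  rw [I.range_eq_univ, mfderivWithin_univ] at this
  exact this

lemma fieldInChart_eq (X : Π x : M, TangentSpace I x) (x : M) (u : EM) :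
    fieldInChart I X x u = dChart I x ((extChartAt I x).symm u) (X ((extChartAt I x).symm u)) := rfl

variable [I.Boundaryless]

lemma dChart_comp_dChartSymm [IsManifold I 1 M] {x : M} {u : EM}
    (hu : u ∈ (extChartAt I x).target) :
    (dChart I x ((extChartAt I x).symm u)).comp
      (dChartSymm I x u) = ContinuousLinearMap.id ℝ EM := by
  have := mfderiv_extChartAt_comp_mfderivWithin_extChartAt_symm (I := I) hu
  rw [I.range_eq_univ, mfderivWithin_univ] at this
  exact this

lemma dChartSymm_comp_dChart [IsManifold I 1 M] {x y : M} (hy : y ∈ (extChartAt I x).source) :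
    (dChartSymm I x (extChartAt I x y)).comp (dChart I x y) = ContinuousLinearMap.id ℝ EM := by
  have := mfderivWithin_extChartAt_symm_comp_mfderiv_extChartAt' (I := I) hy
  rw [I.range_eq_univ, mfderivWithin_univ] at this
  exact this

lemma dChart_dChartSymm [IsManifold I 1 M] {x : M} {u : EM} (hu : u ∈ (extChartAt I x).target)
    (v : EM) :
    dChart I x ((extChartAt I x).symm u) (dChartSymm I x u v) = v :=
  DFunLike.congr_fun (dChart_comp_dChartSymm I hu) v

lemma dChartSymm_dChart [IsManifold I 1 M] {x y : M} (hy : y ∈ (extChartAt I x).source) (v : EM) :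
    dChartSymm I x (extChartAt I x y) (dChart I x y v) = v :=
  DFunLike.congr_fun (dChartSymm_comp_dChart I hy) v

lemma mdifferentiableAt_extChartAt_symm' [IsManifold I 1 M] {x : M} {u : EM}
    (hu : u ∈ (extChartAt I x).target) :
    MDifferentiableAt 𝓘(ℝ, EM) I (extChartAt I x).symm u := by
  have := mdifferentiableWithinAt_extChartAt_symm (I := I) hu
  rwa [I.range_eq_univ, mdifferentiableWithinAt_univ] at this

/-- The derivative of a transition map between preferred charts. -/
lemma hasFDerivAt_transition [IsManifold I 1 M] {x x' : M} {u : EM}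
    (hu : u ∈ (extChartAt I x).target)
    (hx' : (extChartAt I x).symm u ∈ (chartAt HM x').source) :
    HasFDerivAt (fun u => extChartAt I x' ((extChartAt I x).symm u))
      ((dChart I x' ((extChartAt I x).symm u)).comp (dChartSymm I x u)) u := by
  have h1 := (mdifferentiableAt_extChartAt (I := I) hx').hasMFDerivAt
  have h2 := (mdifferentiableAt_extChartAt_symm' I hu).hasMFDerivAt
  exact (h1.comp u h2).hasFDerivAt

lemma contDiffAt_transition [IsManifold I ∞ M] {x x' : M} {u : EM}
    (hu : u ∈ (extChartAt I x).target)
    (hx' : (extChartAt I x).symm u ∈ (chartAt HM x').source) :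
    ContDiffAt ℝ ∞ (fun u => extChartAt I x' ((extChartAt I x).symm u)) u := by
  have h1 : ContMDiffAt I 𝓘(ℝ, EM) ∞ (extChartAt I x') ((extChartAt I x).symm u) :=
    contMDiffAt_extChartAt' hx'
  have h2 : ContMDiffAt 𝓘(ℝ, EM) I ∞ (extChartAt I x).symm u :=
    (contMDiffOn_extChartAt_symm x).contMDiffAt ((isOpen_extChartAt_target x).mem_nhds hu)
  exact (h1.comp u h2).contDiffAt

/-- The second derivative at `y` of the transition map from the preferred chart at `x` to that at
`x'`. -/
def transitionHessian (x x' y : M) : EM →L[ℝ] EM →L[ℝ] EM :=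
  fderiv ℝ (fderiv ℝ fun u => extChartAt I x' ((extChartAt I x).symm u)) (extChartAt I x y)

/-- Schwarz's theorem for the smooth transition map. This symmetry is what makes both `X^{1*}` and
`ω^A` take the same form in every natural chart. -/
lemma transitionHessian_symm [IsManifold I ∞ M] {x x' y : M}
    (hy : y ∈ (extChartAt I x).source) (hy' : y ∈ (extChartAt I x').source) (v w : EM) :
    transitionHessian I x x' y v w = transitionHessian I x x' y w v := by
  have h := contDiffAt_transition I (x' := x') ((extChartAt I x).map_source hy)
    (by rw [(extChartAt I x).left_inv hy]; rwa [extChartAt_source] at hy')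
  exact (h.isSymmSndFDerivAt (by simp; norm_cast)) v w

lemma hasFDerivAt_fderiv_transition [IsManifold I ∞ M] {x x' y : M}
    (hy : y ∈ (extChartAt I x).source) (hy' : y ∈ (extChartAt I x').source) :
    HasFDerivAt (fderiv ℝ fun u => extChartAt I x' ((extChartAt I x).symm u))
      (transitionHessian I x x' y) (extChartAt I x y) := by
  have h := contDiffAt_transition I (x' := x') ((extChartAt I x).map_source hy)
    (by rw [(extChartAt I x).left_inv hy]; rwa [extChartAt_source] at hy')
  exact ((h.fderiv_right (m := 1) (by norm_cast)).differentiableAt one_ne_zero).hasFDerivAt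

lemma eventually_mem_target_source {x x' y : M}
    (hy : y ∈ (extChartAt I x).source) (hy' : y ∈ (extChartAt I x').source) :
    ∀ᶠ u in 𝓝 (extChartAt I x y), u ∈ (extChartAt I x).target ∧
      (extChartAt I x).symm u ∈ (extChartAt I x').source := by
  have h1 := extChartAt_target_mem_nhds' ((extChartAt I x).map_source hy)
  have h2 : ContinuousAt (extChartAt I x).symm
      (extChartAt I x y) := continuousAt_extChartAt_symm' hy
  refine Filter.Eventually.and h1 (h2.eventually_mem ?_)
  rw [(extChartAt I x).left_inv hy]
  exact extChartAt_source_mem_nhds' hy'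

lemma mvfderiv_eq_fderiv_chart [IsManifold I 1 M] {F : Type*} [NormedAddCommGroup F]
    [NormedSpace ℝ F]
    (f : M → F) (x : M) (v : TangentSpace I x) :
    mvfderiv I f x v
      = fderiv ℝ (fun u => f ((extChartAt I x).symm u)) (extChartAt I x x) (dChart I x x v) := by
  by_cases hf : MDifferentiableAt I 𝓘(ℝ, F) f x
  · have h1 : HasMFDerivAt I 𝓘(ℝ, F) f ((extChartAt I x).symm (extChartAt I x x))
        (mvfderiv I f x : EM →L[ℝ] F) := by
      rw [extChartAt_to_inv]; exact hf.hasMFDerivAt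
    have h2 := (mdifferentiableAt_extChartAt_symm' I (mem_extChartAt_target x)).hasMFDerivAt
    have h3 : HasFDerivAt (fun u => f ((extChartAt I x).symm u))
        ((mvfderiv I f x : EM →L[ℝ] F).comp (dChartSymm I x (extChartAt I x x)))
          (extChartAt I x x) :=
      (h1.comp _ h2).hasFDerivAt
    rw [h3.fderiv]
    exact congrArg (mvfderiv I f x : EM →L[ℝ] F)
      (dChartSymm_dChart I (mem_extChartAt_source x) v).symm
  -- Differentiability passes through the chart in both directions, so where it fails both
  -- derivatives take the default value 0.
  · have h0 : ¬ DifferentiableAt ℝ (fun u => f ((extChartAt I x).symm u)) (extChartAt I x x) := by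
      intro h
      apply hf
      have h1 := h.mdifferentiableAt.comp x
        (mdifferentiableAt_extChartAt (I := I) (mem_chart_source HM x))
      refine h1.congr_of_eventuallyEq ?_
      filter_upwards [extChartAt_source_mem_nhds (I := I) x] with y hy
      exact congrArg f ((extChartAt I x).left_inv hy).symm
    rw [fderiv_zero_of_not_differentiableAt h0, mvfderiv, mfderiv_zero_of_not_mdifferentiableAt hf]
    rfl

/-- The bracket on `M` is defined by pulling fields back along the inverse chart, which applies the
inverse of `dChartSymm`. On the chart target that inverse is `dChart`, so the pulled-back fields are
the chart expressions. -/
lemma dChart_mlieBracket [IsManifold I 1 M] [CompleteSpace EM] (Y Z : Π x : M, TangentSpace I x)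
    (x : M) :
    dChart I x x (mlieBracket I Y Z x)
      = lieBracket ℝ (fieldInChart I Y x) (fieldInChart I Z x) (extChartAt I x x) := by
  have key : ∀ V : Π x : M, TangentSpace I x,
      mpullbackWithin 𝓘(ℝ, EM) I (extChartAt I x).symm V (Set.range I)
        =ᶠ[𝓝 (extChartAt I x x)] fieldInChart I V x := by
    intro V
    filter_upwards [extChartAt_target_mem_nhds (I := I) x] with u hu
    rw [mpullbackWithin_apply, I.range_eq_univ, mfderivWithin_univ]
    have h1 := dChart_comp_dChartSymm I hu
    have h2 := dChartSymm_comp_dChart I ((extChartAt I x).map_target hu)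
    rw [(extChartAt I x).right_inv hu] at h2
    have := ContinuousLinearMap.inverse_eq h2 h1
    exact DFunLike.congr_fun this _
  have h : (mlieBracket I Y Z x : EM) = (dChart I x x).inverse
      (lieBracket ℝ (fieldInChart I Y x) (fieldInChart I Z x) (extChartAt I x x)) := by
    rw [← mlieBracketWithin_univ, mlieBracketWithin_apply]
    have hs : ((extChartAt I x).symm ⁻¹' Set.univ ∩ Set.range I : Set EM) = Set.univ := by
      rw [I.range_eq_univ]; simp
    rw [hs]
    have aux : ∀ V W V' W' : EM → EM, V =ᶠ[𝓝 (extChartAt I x x)] V' →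
        W =ᶠ[𝓝 (extChartAt I x x)] W' → lieBracketWithin ℝ V W Set.univ (extChartAt I x x)
          = lieBracket ℝ V' W' (extChartAt I x x) := by
      intro V W V' W' hV hW
      rw [lieBracketWithin_univ, hV.lieBracket_vectorField_eq hW]
    exact congrArg (fun v : EM => (dChart I x x).inverse v) (aux _ _ _ _ (key Y) (key Z))
  rw [h]
  have hinv : (dChart I x x).IsInvertible := isInvertible_mfderiv_extChartAt
      (mem_extChartAt_source x)
  obtain ⟨e, he⟩ := hinv
  rw [← he]
  simp

/-- The trivialization of the tangent bundle at `x` acts on fibres as `dChart I x`, so smoothness of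
the section is smoothness of its coordinates. -/
lemma smoothFieldAt_iff [IsManifold I ∞ M] [IsManifold I 1 M]
    (X : Π x : M, TangentSpace I x) {x y : M} (hy : y ∈ (extChartAt I x).source) :
    SmoothFieldAt I X y ↔ ContDiffAt ℝ ∞ (fieldInChart I X x) (extChartAt I x y) := by
  have hy' : y ∈ (chartAt HM x).source := by rwa [extChartAt_source] at hy
  refine ((trivializationAt EM (TangentSpace I) x).contMDiffAt_section_iff (IB := I) (n := ∞)
    (s := X) (F := EM) (x₀ := y) hy').trans ?_
  have e1 : (fun y => (trivializationAt EM (TangentSpace I) x ⟨y, X y⟩).2)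
      =ᶠ[𝓝 y] fun y => dChart I x y (X y) := by
    filter_upwards [(chartAt HM x).open_source.mem_nhds hy'] with y hy
    have h2 := DFunLike.congr_fun
      (TangentBundle.continuousLinearMapAt_trivializationAt (I := I) hy) (X y)
    rw [← Trivialization.continuousLinearMapAt_apply_of_mem (R := ℝ)]
    · exact h2
    · exact hy
  refine e1.contMDiffAt_iff.trans ?_
  rw [← contMDiffAt_iff_contDiffAt]
  have hs : ContMDiffAt 𝓘(ℝ, EM) I ∞ (extChartAt I x).symm (extChartAt I x y) :=
    (contMDiffOn_extChartAt_symm x).contMDiffAt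
      (extChartAt_target_mem_nhds' ((extChartAt I x).map_source hy))
  constructor
  · intro h
    have h' : ContMDiffAt I 𝓘(ℝ, EM) ∞ (fun y => dChart I x y (X y))
        ((extChartAt I x).symm (extChartAt I x y)) := by rwa [(extChartAt I x).left_inv hy]
    exact h'.comp _ hs
  · intro h
    refine (h.comp y (contMDiffAt_extChartAt' hy')).congr_of_eventuallyEq ?_
    filter_upwards [extChartAt_source_mem_nhds' (I := I) hy] with y hy
    rw [Function.comp_apply, fieldInChart_eq, (extChartAt I x).left_inv hy]

/-- The transformation rule for the derivative of the expression of a vector field in charts. -/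
lemma fderiv_fieldInChart_transition [IsManifold I ∞ M] [IsManifold I 1 M]
    {X : Π x : M, TangentSpace I x} {x x' y : M}
    (hy : y ∈ (extChartAt I x).source) (hy' : y ∈ (extChartAt I x').source)
    (hX : SmoothFieldAt I X y) (w : EM) :
    fderiv ℝ (fieldInChart I X x') (extChartAt I x' y)
        (dChart I x' y (dChartSymm I x (extChartAt I x y) w))
      = transitionHessian I x x' y w (fieldInChart I X x (extChartAt I x y))
        + dChart I x' y (dChartSymm I x (extChartAt I x y)
          (fderiv ℝ (fieldInChart I X x) (extChartAt I x y) w)) := by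
  have d1 := (((smoothFieldAt_iff I X hy).1 hX).differentiableAt (by simp)).hasFDerivAt
  have d2 := (((smoothFieldAt_iff I X hy').1 hX).differentiableAt (by simp)).hasFDerivAt
  have hl := (extChartAt I x).left_inv hy
  have h := hasFDerivAt_fderiv_transition I hy hy'
  have hσ : HasFDerivAt (fun u => extChartAt I x' ((extChartAt I x).symm u))
      ((dChart I x' y).comp (dChartSymm I x (extChartAt I x y))) (extChartAt I x y) := by
    have := hasFDerivAt_transition I (x' := x') ((extChartAt I x).map_source hy)
      (by rw [hl]; rwa [extChartAt_source] at hy')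
    rwa [hl] at this
  have d3 : HasFDerivAt (fieldInChart I X x') (fderiv ℝ (fieldInChart I X x') (extChartAt I x' y))
      (extChartAt I x' ((extChartAt I x).symm (extChartAt I x y))) := by rwa [hl]
  -- With `τ` the transition map, vector fields transform by `X' ∘ τ = Dτ · X`. Differentiating this
  -- identity by the product rule yields the Hessian term.
  have e : (fun u => fieldInChart I X x' (extChartAt I x' ((extChartAt I x).symm u)))
      =ᶠ[𝓝 (extChartAt I x y)] fun u =>
        (fderiv ℝ fun u => extChartAt I x' ((extChartAt I x).symm u)) u (fieldInChart I X x u) := by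
    filter_upwards [eventually_mem_target_source I hy hy'] with u ⟨hu, hu'⟩
    rw [(hasFDerivAt_transition I hu (by rwa [extChartAt_source] at hu')).fderiv]
    rw [fieldInChart_eq, (extChartAt I x').left_inv hu', fieldInChart_eq]
    have h1 := dChartSymm_dChart I ((extChartAt I x).map_target hu)
      (X ((extChartAt I x).symm u))
    rw [(extChartAt I x).right_inv hu] at h1
    exact (congrArg (dChart I x' ((extChartAt I x).symm u)) h1).symm
  have h3 := (d3.comp (extChartAt I x y) hσ).congr_of_eventuallyEq e.symm
  have h4 := h3.unique (h.clm_apply d1)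
  have h5 := DFunLike.congr_fun h4 w
  rw [hσ.fderiv] at h5
  simp only [ContinuousLinearMap.comp_apply, add_apply,
    ContinuousLinearMap.flip_apply] at h5
  rw [h5, add_comm]

/-- The derivatives of `Z` and `W` produced by the product rule cancel those inside the two
brackets. What remains is tensorial in `Z` and `W`: `DT'(Y) + T'(DY ·, ·) + T'(·, DY ·)`. -/
lemma lieDerivTwo_eq [IsManifold I 1 M] [CompleteSpace EM] {x : M}
    {Y Z W : Π x : M, TangentSpace I x}
    {T : Π x : M, TangentSpace I x →L[ℝ] TangentSpace I x →L[ℝ] ℝ}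
    {T' : EM → EM →L[ℝ] EM →L[ℝ] ℝ}
    (hT : ∀ u ∈ (extChartAt I x).target, ∀ v w : EM,
      T ((extChartAt I x).symm u) v w = T' u (dChart I x ((extChartAt I x).symm u) v)
        (dChart I x ((extChartAt I x).symm u) w))
    (hT' : DifferentiableAt ℝ T' (extChartAt I x x))
    (hZ : DifferentiableAt ℝ (fieldInChart I Z x) (extChartAt I x x))
    (hW : DifferentiableAt ℝ (fieldInChart I W x) (extChartAt I x x)) :
    lieDerivTwo I Y T Z W x
      = fderiv ℝ T' (extChartAt I x x) (fieldInChart I Y x (extChartAt I x x))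
          (fieldInChart I Z x (extChartAt I x x)) (fieldInChart I W x (extChartAt I x x))
        + T' (extChartAt I x x)
          (fderiv ℝ (fieldInChart I Y x) (extChartAt I x x)
            (fieldInChart I Z x (extChartAt I x x)))
          (fieldInChart I W x (extChartAt I x x))
        + T' (extChartAt I x x) (fieldInChart I Z x (extChartAt I x x))
          (fderiv ℝ (fieldInChart I Y x) (extChartAt I x x)
            (fieldInChart I W x (extChartAt I x x))) := by
  have hx : (extChartAt I x).symm (extChartAt I x x) = x := extChartAt_to_inv x
  have hT0 : ∀ v w : EM, T x v w = T' (extChartAt I x x) (dChart I x x v) (dChart I x x w) := by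
    have := hT _ (mem_extChartAt_target x)
    rwa [hx] at this
  have hV : ∀ V : Π x : M, TangentSpace I x,
      dChart I x x (V x) = fieldInChart I V x (extChartAt I x x) := by
    intro V; rw [fieldInChart_eq, hx]
  unfold lieDerivTwo
  rw [mvfderiv_eq_fderiv_chart]
  have e : (fun u => T ((extChartAt I x).symm u) (Z ((extChartAt I x).symm u))
      (W ((extChartAt I x).symm u))) =ᶠ[𝓝 (extChartAt I x x)]
      fun u => T' u (fieldInChart I Z x u) (fieldInChart I W x u) := by
    filter_upwards [extChartAt_target_mem_nhds (I := I) x] with u hu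
    exact hT u hu _ _
  rw [e.fderiv_eq, hV, ((hT'.hasFDerivAt.clm_apply hZ.hasFDerivAt).clm_apply
    hW.hasFDerivAt).fderiv]
  have h1 := hT0 (mlieBracket I Y Z x) (W x)
  have h2 := hT0 (Z x) (mlieBracket I Y W x)
  rw [dChart_mlieBracket, hV] at h1 h2
  refine (congrArg₂ _ (congrArg₂ _ rfl h1) h2).trans ?_
  simp only [lieBracket, add_apply, ContinuousLinearMap.flip_apply,
    ContinuousLinearMap.comp_apply, map_sub, sub_apply]
  ring

end ChartCalculus

/-! ### Natural coordinates on the phase space -/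

section PhaseCharts

variable {k : ℕ} {E : Type*} [NormedAddCommGroup E] [NormedSpace ℝ E]
  {Q : Type*} [TopologicalSpace Q] [ChartedSpace E Q] [IsManifold 𝓘(ℝ, E) ∞ Q]

/-- The covectors of a point of the phase space, as a linear map from the model space. -/
def momentum (x : PhaseSpace k E Q) : E →L[ℝ] (Fin k → ℝ) := x.2.snd

/-- The point of the phase space with time `t`, position `q` and covectors `α`. -/
def mkPhase (t : Fin k → ℝ) (q : Q) (α : E →L[ℝ] (Fin k → ℝ)) : PhaseSpace k E Q := (t, ⟨q, α⟩)

lemma mem_phase_source {x y : PhaseSpace k E Q} :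
    y ∈ (extChartAt (phaseModel k E) x).source ↔
      y.2.proj ∈ (extChartAt 𝓘(ℝ, E) x.2.proj).source := by
  simp only [extChartAt_source]
  change y.1 ∈ (chartAt (Fin k → ℝ) x.1).source ∧ y.2 ∈ (chartAt (ModelProd E _) x.2).source ↔ _
  rw [FiberBundle.chartedSpace_chartAt]
  have hfst : (trivializationAt (E →L[ℝ] Fin k → ℝ)
      (fun q : Q => TangentSpace 𝓘(ℝ, E) q →L[ℝ] Trivial Q (Fin k → ℝ) q) x.2.proj y.2).1
      = y.2.proj := rfl
  simp [hfst]
  exact fun _ => Set.mem_univ _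

/-- The Hom bundle is trivialized by precomposing with the inverse trivialization of `TQ`, which is
`dChartSymm`. The target bundle is trivial and contributes the identity. -/
lemma phase_extChartAt {x y : PhaseSpace k E Q}
    (h : y.2.proj ∈ (extChartAt 𝓘(ℝ, E) x.2.proj).source) :
    extChartAt (phaseModel k E) x y =
      (y.1, extChartAt 𝓘(ℝ, E) x.2.proj y.2.proj,
        (momentum y).comp (dChartSymm 𝓘(ℝ, E) x.2.proj
          (extChartAt 𝓘(ℝ, E) x.2.proj y.2.proj))) := by
  rw [extChartAt_source] at h
  have h0 : extChartAt (phaseModel k E) x y = (y.1, chartAt (ModelProd E _) x.2 y.2) := rfl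
  rw [h0, hom_chart]
  have h1 := TangentBundle.symmL_trivializationAt (I := 𝓘(ℝ, E)) h
  rw [ModelWithCorners.range_eq_univ, mfderivWithin_univ] at h1
  have h2 : ContinuousLinearMap.inCoordinates E (TangentSpace 𝓘(ℝ, E) : Q → Type _) (Fin k → ℝ)
      (Trivial Q (Fin k → ℝ)) x.2.proj y.2.proj x.2.proj y.2.proj y.2.snd
      = (momentum y).comp (dChartSymm 𝓘(ℝ, E) x.2.proj
          (extChartAt 𝓘(ℝ, E) x.2.proj y.2.proj)) := by
    ext v i
    unfold ContinuousLinearMap.inCoordinates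
    have h3 : (trivializationAt (Fin k → ℝ) (Trivial Q (Fin k → ℝ)) x.2.proj).continuousLinearMapAt
        ℝ y.2.proj = ContinuousLinearMap.id ℝ (Fin k → ℝ) :=
      Bundle.Trivial.continuousLinearMapAt_trivialization ..
    rw [h3, h1]
    rfl
  rw [h2]
  rfl

lemma phase_extChartAt_symm_aux {x : PhaseSpace k E Q}
    {u : (Fin k → ℝ) × E × (E →L[ℝ] (Fin k → ℝ))}
    (h : u.2.1 ∈ (extChartAt 𝓘(ℝ, E) x.2.proj).target) :
    extChartAt (phaseModel k E) x (mkPhase u.1 ((extChartAt 𝓘(ℝ, E) x.2.proj).symm u.2.1)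
      (u.2.2.comp (dChart 𝓘(ℝ, E) x.2.proj ((extChartAt 𝓘(ℝ, E) x.2.proj).symm u.2.1)))) = u := by
  rw [phase_extChartAt (by exact (extChartAt 𝓘(ℝ, E) x.2.proj).map_target h)]
  refine Prod.ext rfl (Prod.ext ((extChartAt 𝓘(ℝ, E) x.2.proj).right_inv h) ?_)
  change (u.2.2.comp (dChart 𝓘(ℝ, E) x.2.proj ((extChartAt 𝓘(ℝ, E) x.2.proj).symm u.2.1))).comp
    (dChartSymm 𝓘(ℝ, E) x.2.proj (extChartAt 𝓘(ℝ, E) x.2.proj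
      ((extChartAt 𝓘(ℝ, E) x.2.proj).symm u.2.1))) = u.2.2
  rw [(extChartAt 𝓘(ℝ, E) x.2.proj).right_inv h, ContinuousLinearMap.comp_assoc,
    dChart_comp_dChartSymm 𝓘(ℝ, E) h, ContinuousLinearMap.comp_id]

lemma mem_phase_target {x : PhaseSpace k E Q} {u : (Fin k → ℝ) × E × (E →L[ℝ] (Fin k → ℝ))} :
    u ∈ (extChartAt (phaseModel k E) x).target ↔
      u.2.1 ∈ (extChartAt 𝓘(ℝ, E) x.2.proj).target := by
  constructor
  · intro h
    have h1 := mem_phase_source.1 ((extChartAt (phaseModel k E) x).map_target h)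
    have h2 := (extChartAt (phaseModel k E) x).right_inv h
    rw [phase_extChartAt h1] at h2
    rw [← h2]
    exact (extChartAt 𝓘(ℝ, E) x.2.proj).map_source h1
  · intro h
    have h1 := phase_extChartAt_symm_aux h
    rw [← h1]
    exact (extChartAt (phaseModel k E) x).map_source
      (mem_phase_source.2 ((extChartAt 𝓘(ℝ, E) x.2.proj).map_target h))

lemma phase_extChartAt_symm {x : PhaseSpace k E Q}
    {u : (Fin k → ℝ) × E × (E →L[ℝ] (Fin k → ℝ))}
    (h : u.2.1 ∈ (extChartAt 𝓘(ℝ, E) x.2.proj).target) :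
    (extChartAt (phaseModel k E) x).symm u =
      mkPhase u.1 ((extChartAt 𝓘(ℝ, E) x.2.proj).symm u.2.1)
      (u.2.2.comp (dChart 𝓘(ℝ, E) x.2.proj ((extChartAt 𝓘(ℝ, E) x.2.proj).symm u.2.1))) := by
  have h1 := phase_extChartAt_symm_aux h
  conv_lhs => rw [← h1]
  exact (extChartAt (phaseModel k E) x).left_inv
      (mem_phase_source.2 ((extChartAt 𝓘(ℝ, E) x.2.proj).map_target h))

end PhaseCharts

/-! ### Changes of natural coordinates -/

section PhaseTransition

variable {k : ℕ} {E : Type*} [NormedAddCommGroup E] [NormedSpace ℝ E]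
  {Q : Type*} [TopologicalSpace Q] [ChartedSpace E Q] [IsManifold 𝓘(ℝ, E) ∞ Q]

lemma phase_extChartAt_self (x : PhaseSpace k E Q) :
    extChartAt (phaseModel k E) x x
      = (x.1, extChartAt 𝓘(ℝ, E) x.2.proj x.2.proj, momentum x) := by
  rw [phase_extChartAt (mem_extChartAt_source _), dChartSymm_self, ContinuousLinearMap.comp_id]

/-- The derivative of the natural chart at `x` at a point `y` (whose tangent space is identified
with the model space by the natural chart at `y`). -/
lemma dChart_phase {x y : PhaseSpace k E Q}
    (h : y.2.proj ∈ (extChartAt 𝓘(ℝ, E) x.2.proj).source)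
    (v : (Fin k → ℝ) × E × (E →L[ℝ] (Fin k → ℝ))) :
    dChart (phaseModel k E) x y v =
      (v.1, dChart 𝓘(ℝ, E) x.2.proj y.2.proj v.2.1,
        v.2.2.comp (dChartSymm 𝓘(ℝ, E) x.2.proj (extChartAt 𝓘(ℝ, E) x.2.proj y.2.proj))
        + (momentum y).comp (transitionHessian 𝓘(ℝ, E) x.2.proj y.2.proj y.2.proj
            (dChart 𝓘(ℝ, E) x.2.proj y.2.proj v.2.1))) := by
  set e := extChartAt 𝓘(ℝ, E) x.2.proj with he
  set e' := extChartAt 𝓘(ℝ, E) y.2.proj with he'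
  have hs : y.2.proj ∈ e'.source := mem_extChartAt_source _
  have hyt : extChartAt (phaseModel k E) y y ∈ (extChartAt (phaseModel k E) y).target :=
    mem_extChartAt_target y
  have h1 := hasFDerivAt_transition (phaseModel k E) (x' := x) hyt
    (by rw [extChartAt_to_inv]; have := mem_phase_source.2 h; rwa [extChartAt_source] at this)
  rw [extChartAt_to_inv, dChartSymm_self, ContinuousLinearMap.comp_id, phase_extChartAt_self] at h1
  have hτ : HasFDerivAt (fun u => e (e'.symm u)) (dChart 𝓘(ℝ, E) x.2.proj y.2.proj)
      (e' y.2.proj) := by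
    have := hasFDerivAt_transition 𝓘(ℝ, E) (x := y.2.proj) (x' := x.2.proj)
      (mem_extChartAt_target y.2.proj)
      (by rw [extChartAt_to_inv]; rwa [he, extChartAt_source] at h)
    rwa [extChartAt_to_inv, dChartSymm_self, ContinuousLinearMap.comp_id] at this
  have hS := hasFDerivAt_fderiv_transition 𝓘(ℝ, E) h hs
  have hS' : HasFDerivAt (fderiv ℝ fun u => e' (e.symm u))
      (transitionHessian 𝓘(ℝ, E) x.2.proj y.2.proj y.2.proj) (e (e'.symm (e' y.2.proj))) := by
    rw [e'.left_inv hs]; exact hS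
  have hB : fderiv ℝ (fun u => e' (e.symm u)) (e y.2.proj)
      = dChartSymm 𝓘(ℝ, E) x.2.proj (e y.2.proj) := by
    have := hasFDerivAt_transition 𝓘(ℝ, E) (x := x.2.proj) (x' := y.2.proj) (e.map_source h)
      (by rw [← he, e.left_inv h]; rwa [he', extChartAt_source] at hs)
    rw [← he, e.left_inv h, dChart_self, ContinuousLinearMap.id_comp] at this
    exact this.fderiv
  set u₀ : (Fin k → ℝ) × E × (E →L[ℝ] (Fin k → ℝ)) := (y.1, e' y.2.proj, momentum y) with hu₀
  have p0 : HasFDerivAt (𝕜 := ℝ) (fun u : (Fin k → ℝ) × E × (E →L[ℝ] (Fin k → ℝ)) => u.1) _ u₀ :=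
    hasFDerivAt_fst (𝕜 := ℝ)
  have p1 : HasFDerivAt (𝕜 := ℝ) (fun u : (Fin k → ℝ) × E × (E →L[ℝ] (Fin k → ℝ)) => u.2.1) _ u₀ :=
    (hasFDerivAt_snd (𝕜 := ℝ) (p := u₀)).fst
  have p2 : HasFDerivAt (𝕜 := ℝ) (fun u : (Fin k → ℝ) × E × (E →L[ℝ] (Fin k → ℝ)) => u.2.2) _ u₀ :=
    (hasFDerivAt_snd (𝕜 := ℝ) (p := u₀)).snd
  have q1 : HasFDerivAt (fun u : (Fin k → ℝ) × E × (E →L[ℝ] (Fin k → ℝ)) => e (e'.symm u.2.1))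
      _ u₀ :=
    HasFDerivAt.comp (g := fun u => e (e'.symm u)) u₀ hτ p1
  have q2 : HasFDerivAt (fun u : (Fin k → ℝ) × E × (E →L[ℝ] (Fin k → ℝ)) =>
      (fderiv ℝ fun u => e' (e.symm u)) (e (e'.symm u.2.1))) _ u₀ :=
    HasFDerivAt.comp (g := fderiv ℝ fun u => e' (e.symm u)) u₀ hS' q1
  have h2 := p0.prodMk (q1.prodMk (p2.clm_comp q2))
  -- With `τ` the transition map on `Q`, the natural transition map is `(t, u, p) ↦ (t, τ u, p ∘
  -- D(τ⁻¹)(τ u))`. The Hessian of `τ⁻¹` arises from the last factor.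
  have heq : (fun u => extChartAt (phaseModel k E) x ((extChartAt (phaseModel k E) y).symm u))
      =ᶠ[𝓝 u₀] fun u => (u.1, e (e'.symm u.2.1),
        u.2.2.comp ((fderiv ℝ fun u => e' (e.symm u)) (e (e'.symm u.2.1)))) := by
    have hev := eventually_mem_target_source 𝓘(ℝ, E) hs h
    have hc : Filter.Tendsto (fun u : (Fin k → ℝ) × E × (E →L[ℝ] (Fin k → ℝ)) => u.2.1)
        (𝓝 u₀) (𝓝 (e' y.2.proj)) := p1.continuousAt
    filter_upwards [hc.eventually hev] with u ⟨hu, hu'⟩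
    rw [phase_extChartAt_symm hu, phase_extChartAt (by exact hu')]
    refine Prod.ext rfl (Prod.ext rfl ?_)
    change (u.2.2.comp (dChart 𝓘(ℝ, E) y.2.proj (e'.symm u.2.1))).comp
      (dChartSymm 𝓘(ℝ, E) x.2.proj (e (e'.symm u.2.1))) = u.2.2.comp _
    have := hasFDerivAt_transition 𝓘(ℝ, E) (x := x.2.proj) (x' := y.2.proj)
      (e.map_source hu') (by
        rw [← he, e.left_inv hu']; have := e'.map_target hu; rwa [he', extChartAt_source] at this)
    rw [← he, e.left_inv hu'] at this
    rw [this.fderiv, ContinuousLinearMap.comp_assoc]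
  have h3 := (h1.congr_of_eventuallyEq heq.symm).unique h2
  have h4 := DFunLike.congr_fun h3 v
  rw [h4]
  refine Prod.ext rfl (Prod.ext rfl ?_)
  simp only [hu₀, e'.left_inv hs, hB]
  ext w i
  simp [add_comm]

end PhaseTransition

/-! ### The complete lift in coordinates -/

section CompleteLift

variable {k : ℕ} {E : Type*} [NormedAddCommGroup E] [NormedSpace ℝ E]
  {Q : Type*} [TopologicalSpace Q] [ChartedSpace E Q] [IsManifold 𝓘(ℝ, E) ∞ Q]

lemma completeLift_eq (X : Π q : Q, TangentSpace 𝓘(ℝ, E) q) (y : PhaseSpace k E Q) :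
    completeLift X y =
      ((0, X y.2.proj, -((momentum y).comp (fderiv ℝ (fieldInChart 𝓘(ℝ, E) X y.2.proj)
        (extChartAt 𝓘(ℝ, E) y.2.proj y.2.proj)))) :
        (Fin k → ℝ) × E × (E →L[ℝ] (Fin k → ℝ))) := by
  have h1 : ∀ v : (Fin k → ℝ) × E × (E →L[ℝ] (Fin k → ℝ)),
      dChartSymm (phaseModel k E) y (extChartAt (phaseModel k E) y y) v = v := fun v => by
    rw [dChartSymm_self]; rfl
  refine (h1 _).trans ?_
  rw [phase_extChartAt_self]
  refine Prod.ext rfl (Prod.ext ?_ rfl)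
  change fieldInChart 𝓘(ℝ, E) X y.2.proj (extChartAt 𝓘(ℝ, E) y.2.proj y.2.proj) = X y.2.proj
  rw [fieldInChart_eq, extChartAt_to_inv, dChart_self]
  rfl

/-- In every natural chart, `X^{1*}` is `X^i ∂/∂q^i - p^A_j (∂X^j/∂q^i) ∂/∂p^A_i`. -/
lemma fieldInChart_completeLift {X : Π q : Q, TangentSpace 𝓘(ℝ, E) q}
    (hX : SmoothField 𝓘(ℝ, E) X) {x : PhaseSpace k E Q}
    {u : (Fin k → ℝ) × E × (E →L[ℝ] (Fin k → ℝ))}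
    (hu : u ∈ (extChartAt (phaseModel k E) x).target) :
    fieldInChart (phaseModel k E) (completeLift X) x u =
      (0, fieldInChart 𝓘(ℝ, E) X x.2.proj u.2.1,
        -(u.2.2.comp (fderiv ℝ (fieldInChart 𝓘(ℝ, E) X x.2.proj) u.2.1))) := by
  obtain ⟨y, hy, rfl⟩ : ∃ y ∈ (extChartAt (phaseModel k E) x).source,
      extChartAt (phaseModel k E) x y = u :=
    ⟨_, (extChartAt (phaseModel k E) x).map_target hu, (extChartAt (phaseModel k E) x).right_inv hu⟩
  have hq := mem_phase_source.1 hy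
  have hq' : y.2.proj ∈ (extChartAt 𝓘(ℝ, E) y.2.proj).source := mem_extChartAt_source _
  rw [fieldInChart_eq, (extChartAt (phaseModel k E) x).left_inv hy, completeLift_eq,
    dChart_phase hq, phase_extChartAt hq]
  have hXq : fieldInChart 𝓘(ℝ, E) X x.2.proj (extChartAt 𝓘(ℝ, E) x.2.proj y.2.proj)
      = dChart 𝓘(ℝ, E) x.2.proj y.2.proj (X y.2.proj) := by
    rw [fieldInChart_eq, (extChartAt 𝓘(ℝ, E) x.2.proj).left_inv hq]
  refine Prod.ext rfl (Prod.ext hXq.symm ?_)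
  ext w i
  -- Two Hessian terms meet here: one from the momentum part of `dChart_phase`, one from the
  -- transformation of `DX`. They enter with opposite signs and swapped arguments, so symmetry
  -- cancels them.
  have h1 := fderiv_fieldInChart_transition 𝓘(ℝ, E) hq hq' (hX y.2.proj) w
  rw [dChart_self, hXq, transitionHessian_symm 𝓘(ℝ, E) hq hq'] at h1
  simp only [ContinuousLinearMap.id_apply] at h1
  simp only [add_apply, ContinuousLinearMap.comp_apply, neg_apply, h1, map_add, Pi.add_apply,
    Pi.neg_apply]
  ring

lemma hasFDerivAt_phase_fst (u : (Fin k → ℝ) × E × (E →L[ℝ] (Fin k → ℝ))) :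
    HasFDerivAt (𝕜 := ℝ) (fun u : (Fin k → ℝ) × E × (E →L[ℝ] (Fin k → ℝ)) => u.2.1)
      ((ContinuousLinearMap.fst ℝ E (E →L[ℝ] (Fin k → ℝ))).comp
        (ContinuousLinearMap.snd ℝ (Fin k → ℝ) (E × (E →L[ℝ] (Fin k → ℝ))))) u :=
  (hasFDerivAt_snd (𝕜 := ℝ) (p := u)).fst

lemma hasFDerivAt_phase_snd (u : (Fin k → ℝ) × E × (E →L[ℝ] (Fin k → ℝ))) :
    HasFDerivAt (𝕜 := ℝ) (fun u : (Fin k → ℝ) × E × (E →L[ℝ] (Fin k → ℝ)) => u.2.2)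
      ((ContinuousLinearMap.snd ℝ E (E →L[ℝ] (Fin k → ℝ))).comp
        (ContinuousLinearMap.snd ℝ (Fin k → ℝ) (E × (E →L[ℝ] (Fin k → ℝ))))) u :=
  (hasFDerivAt_snd (𝕜 := ℝ) (p := u)).snd

lemma smoothField_completeLift {X : Π q : Q, TangentSpace 𝓘(ℝ, E) q}
    (hX : SmoothField 𝓘(ℝ, E) X) :
    SmoothField (phaseModel k E) (completeLift (k := k) X) := by
  intro x
  rw [smoothFieldAt_iff _ _ (mem_extChartAt_source x)]
  have e : fieldInChart (phaseModel k E) (completeLift X) x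
      =ᶠ[𝓝 (extChartAt (phaseModel k E) x x)] fun u =>
      (0, fieldInChart 𝓘(ℝ, E) X x.2.proj u.2.1,
        -(u.2.2.comp (fderiv ℝ (fieldInChart 𝓘(ℝ, E) X x.2.proj) u.2.1))) := by
    filter_upwards [extChartAt_target_mem_nhds (I := phaseModel k E) x] with u hu
    exact fieldInChart_completeLift hX hu
  refine ContDiffAt.congr_of_eventuallyEq ?_ e
  have hX' : ContDiffAt ℝ ∞ (fieldInChart 𝓘(ℝ, E) X x.2.proj)
      (extChartAt (phaseModel k E) x x).2.1 := by
    rw [phase_extChartAt_self]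
    exact (smoothFieldAt_iff 𝓘(ℝ, E) X (mem_extChartAt_source x.2.proj)).1 (hX _)
  have hDX : ContDiffAt ℝ ∞ (fderiv ℝ (fieldInChart 𝓘(ℝ, E) X x.2.proj))
      (extChartAt (phaseModel k E) x x).2.1 := hX'.fderiv_right (by simp)
  have p1 : ContDiffAt ℝ ∞ (fun u : (Fin k → ℝ) × E × (E →L[ℝ] (Fin k → ℝ)) => u.2.1)
      (extChartAt (phaseModel k E) x x) := contDiffAt_snd.fst
  have p2 : ContDiffAt ℝ ∞ (fun u : (Fin k → ℝ) × E × (E →L[ℝ] (Fin k → ℝ)) => u.2.2)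
      (extChartAt (phaseModel k E) x x) := contDiffAt_snd.snd
  exact contDiffAt_const.prodMk ((ContDiffAt.comp (g := fieldInChart 𝓘(ℝ, E) X x.2.proj)
    (extChartAt (phaseModel k E) x x) hX' p1).prodMk
    (p2.clm_comp (ContDiffAt.comp (g := fderiv ℝ (fieldInChart 𝓘(ℝ, E) X x.2.proj))
      (extChartAt (phaseModel k E) x x) hDX p1)).neg)

/-- The derivative of the coordinate expression of `X^{1*}`. -/
lemma hasFDerivAt_completeLift_coord {X' : E → E} {u : (Fin k → ℝ) × E × (E →L[ℝ] (Fin k → ℝ))}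
    (hX : ContDiffAt ℝ ∞ X' u.2.1) :
    ∃ D : ((Fin k → ℝ) × E × (E →L[ℝ] (Fin k → ℝ))) →L[ℝ]
        ((Fin k → ℝ) × E × (E →L[ℝ] (Fin k → ℝ))),
      HasFDerivAt (fun u : (Fin k → ℝ) × E × (E →L[ℝ] (Fin k → ℝ)) =>
        ((0 : Fin k → ℝ), X' u.2.1, -(u.2.2.comp (fderiv ℝ X' u.2.1)))) D u ∧
      ∀ v, D v = (0, fderiv ℝ X' u.2.1 v.2.1, -(v.2.2.comp (fderiv ℝ X' u.2.1)
        + u.2.2.comp (fderiv ℝ (fderiv ℝ X') u.2.1 v.2.1))) := by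
  have h1 := (hX.differentiableAt (by simp)).hasFDerivAt
  have h2 := ((hX.fderiv_right (m := 1) (by norm_cast)).differentiableAt one_ne_zero).hasFDerivAt
  have p1 := hasFDerivAt_phase_fst u
  have p2 := hasFDerivAt_phase_snd u
  have q1 := HasFDerivAt.comp (g := X') u h1 p1
  have q2 := HasFDerivAt.comp (g := fderiv ℝ X') u h2 p1
  refine ⟨_, (hasFDerivAt_const (0 : Fin k → ℝ) u).prodMk (q1.prodMk (p2.clm_comp q2).neg), ?_⟩
  intro v
  refine Prod.ext rfl (Prod.ext rfl ?_)
  ext w i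
  simp [add_comm]

end CompleteLift

/-! ### The forms `θ^A` and `ω^A`, and invariance of `ω^A` -/

section CanonicalForms

variable {k : ℕ} {E : Type*} [NormedAddCommGroup E] [NormedSpace ℝ E]
  {Q : Type*} [TopologicalSpace Q] [ChartedSpace E Q] [IsManifold 𝓘(ℝ, E) ∞ Q]

/-- The coordinate expression `p^A_i dq^i` of `θ^A`, as a linear function of the point. -/
def thetaCoord (A : Fin k) : ((Fin k → ℝ) × E × (E →L[ℝ] (Fin k → ℝ))) →L[ℝ]
    ((Fin k → ℝ) × E × (E →L[ℝ] (Fin k → ℝ))) →L[ℝ] ℝ :=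
  ((ContinuousLinearMap.compL ℝ ((Fin k → ℝ) × E × (E →L[ℝ] (Fin k → ℝ))) E ℝ).flip
      ((ContinuousLinearMap.fst ℝ E (E →L[ℝ] (Fin k → ℝ))).comp
        (ContinuousLinearMap.snd ℝ (Fin k → ℝ) (E × (E →L[ℝ] (Fin k → ℝ)))))).comp
    ((ContinuousLinearMap.compL ℝ E (Fin k → ℝ) ℝ
        (ContinuousLinearMap.proj (R := ℝ) (φ := fun _ : Fin k => ℝ) A)).comp
      ((ContinuousLinearMap.snd ℝ E (E →L[ℝ] (Fin k → ℝ))).comp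
        (ContinuousLinearMap.snd ℝ (Fin k → ℝ) (E × (E →L[ℝ] (Fin k → ℝ))))))

@[simp] lemma thetaCoord_apply (A : Fin k) (u v : (Fin k → ℝ) × E × (E →L[ℝ] (Fin k → ℝ))) :
    thetaCoord A u v = u.2.2 v.2.1 A := rfl

/-- The coordinate expression `dq^i ∧ dp^A_i` of `ω^A`. -/
def omegaCoord (A : Fin k) : ((Fin k → ℝ) × E × (E →L[ℝ] (Fin k → ℝ))) →L[ℝ]
    ((Fin k → ℝ) × E × (E →L[ℝ] (Fin k → ℝ))) →L[ℝ] ℝ :=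
  (thetaCoord (E := E) A).flip - thetaCoord A

@[simp] lemma omegaCoord_apply (A : Fin k) (v w : (Fin k → ℝ) × E × (E →L[ℝ] (Fin k → ℝ))) :
    omegaCoord A v w = w.2.2 v.2.1 A - v.2.2 w.2.1 A := rfl

/-- The bundle projection reads `(t, u, p) ↦ u`, so it sends `v` to `dChartSymm` of the position
part of `v`. The covector at the point is `p^A ∘ dChart`, and the two chart derivatives cancel. -/
lemma oneFormInChart_thetaForm (A : Fin k) {x : PhaseSpace k E Q}
    {u : (Fin k → ℝ) × E × (E →L[ℝ] (Fin k → ℝ))}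
    (hu : u ∈ (extChartAt (phaseModel k E) x).target) :
    oneFormInChart (phaseModel k E) (thetaForm A) x u = thetaCoord A u := by
  refine ContinuousLinearMap.ext fun v => ?_
  have hu' := mem_phase_target.1 hu
  have hp : MDifferentiableAt (phaseModel k E) 𝓘(ℝ, E) (fun y : PhaseSpace k E Q => y.2.proj)
      ((extChartAt (phaseModel k E) x).symm u) :=
    ((contMDiff_proj _).comp contMDiff_snd |>.mdifferentiable (n := ∞) (by simp)) _
  have h1 := hp.hasMFDerivAt.comp u
      (mdifferentiableAt_extChartAt_symm' (phaseModel k E) hu).hasMFDerivAt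
  have h2 := (mdifferentiableAt_extChartAt_symm' 𝓘(ℝ, E) hu').hasMFDerivAt.comp u
    (hasFDerivAt_phase_fst u).hasMFDerivAt
  have e : ((fun y : PhaseSpace k E Q => y.2.proj) ∘ (extChartAt (phaseModel k E) x).symm)
      =ᶠ[𝓝 u] (extChartAt 𝓘(ℝ, E) x.2.proj).symm ∘
        (fun u : (Fin k → ℝ) × E × (E →L[ℝ] (Fin k → ℝ)) => u.2.1) := by
    filter_upwards [extChartAt_target_mem_nhds' (I := phaseModel k E) hu] with u hu
    simp only [Function.comp_apply]
    rw [phase_extChartAt_symm (mem_phase_target.1 hu)]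
    rfl
  have h3 := DFunLike.congr_fun (hasMFDerivAt_unique h1 (h2.congr_of_eventuallyEq e)) v
  have h4 : oneFormInChart (phaseModel k E) (thetaForm A) x u v
      = covector ((extChartAt (phaseModel k E) x).symm u) A
        (dChartSymm 𝓘(ℝ, E) x.2.proj u.2.1 v.2.1) :=
    congrArg (covector ((extChartAt (phaseModel k E) x).symm u) A) h3
  rw [h4, phase_extChartAt_symm hu']
  change (u.2.2 (dChart 𝓘(ℝ, E) x.2.proj _ (dChartSymm 𝓘(ℝ, E) x.2.proj u.2.1 v.2.1))) A = _
  rw [dChart_dChartSymm 𝓘(ℝ, E) hu']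
  rfl

/-- The coordinate form of `θ^A` is linear in the point, so it is its own derivative and `ω^A` is
minus its antisymmetrization. -/
lemma omegaForm_eq (A : Fin k) (y : PhaseSpace k E Q)
    (v w : (Fin k → ℝ) × E × (E →L[ℝ] (Fin k → ℝ))) :
    omegaForm A y v w = omegaCoord A v w := by
  have e : oneFormInChart (phaseModel k E) (thetaForm A) y
      =ᶠ[𝓝 (extChartAt (phaseModel k E) y y)] thetaCoord A := by
    filter_upwards [extChartAt_target_mem_nhds (I := phaseModel k E) y] with u hu
    exact oneFormInChart_thetaForm A hu
  have hD : fderiv ℝ (oneFormInChart (phaseModel k E) (thetaForm A) y)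
      (extChartAt (phaseModel k E) y y) = thetaCoord A := by
    rw [e.fderiv_eq, ContinuousLinearMap.fderiv]
  have h : omegaForm A y v w = -(extDerivOne (phaseModel k E) (thetaForm A) y v w) := rfl
  rw [h, extDerivOne_apply, hD]
  simp

/-- In every natural chart, `ω^A` is `dq^i ∧ dp^A_i`. -/
lemma omegaForm_chart (A : Fin k) {x y : PhaseSpace k E Q}
    (h : y.2.proj ∈ (extChartAt 𝓘(ℝ, E) x.2.proj).source)
    (v w : (Fin k → ℝ) × E × (E →L[ℝ] (Fin k → ℝ))) :
    omegaForm A y v w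
      = omegaCoord A (dChart (phaseModel k E) x y v) (dChart (phaseModel k E) x y w) := by
  rw [omegaForm_eq, dChart_phase h, dChart_phase h]
  simp only [omegaCoord_apply, add_apply, ContinuousLinearMap.comp_apply,
    dChartSymm_dChart 𝓘(ℝ, E) h, Pi.add_apply]
  -- The remaining discrepancy is the Hessian at `(w, v)` minus the Hessian at `(v, w)`, each paired
  -- with the momentum.
  rw [transitionHessian_symm 𝓘(ℝ, E) h (mem_extChartAt_source _)]
  ring

/-- Since `ω^A` is constant in coordinates, only `ω(DY z, w) + ω(z, DY w)` survives. The terms in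
`DX` cancel because momenta transform dually to positions, and those in `D²X` by symmetry of the
second derivative. -/
lemma lieDerivTwo_completeLift_omegaForm [FiniteDimensional ℝ E]
    {X : Π q : Q, TangentSpace 𝓘(ℝ, E) q}
    (hX : SmoothField 𝓘(ℝ, E) X) (A : Fin k) :
    LieDerivTwoEqZero (phaseModel k E) (completeLift (k := k) X)
      (omegaForm A) := by
  intro (x : PhaseSpace k E Q) Z W hZ hW
  have : FiniteDimensional ℝ (E →L[ℝ] (Fin k → ℝ)) := inferInstance
  have : CompleteSpace ((Fin k → ℝ) × E × (E →L[ℝ] (Fin k → ℝ))) := FiniteDimensional.complete ℝ _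
  have hZ' := ((smoothFieldAt_iff _ _ (mem_extChartAt_source x)).1 hZ).differentiableAt (by simp)
  have hW' := ((smoothFieldAt_iff _ _ (mem_extChartAt_source x)).1 hW).differentiableAt (by simp)
  rw [lieDerivTwo_eq (phaseModel k E) (T' := fun _ => omegaCoord A) (fun u hu v w =>
    omegaForm_chart A (mem_phase_source.1 ((extChartAt (phaseModel k E) x).map_target hu)) v w)
    (differentiableAt_const _) hZ' hW']
  have e : fieldInChart (phaseModel k E) (completeLift X) x
      =ᶠ[𝓝 (extChartAt (phaseModel k E) x x)] fun u =>
      (0, fieldInChart 𝓘(ℝ, E) X x.2.proj u.2.1,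
        -(u.2.2.comp (fderiv ℝ (fieldInChart 𝓘(ℝ, E) X x.2.proj) u.2.1))) := by
    filter_upwards [extChartAt_target_mem_nhds (I := phaseModel k E) x] with u hu
    exact fieldInChart_completeLift hX hu
  have hX' : ContDiffAt ℝ ∞ (fieldInChart 𝓘(ℝ, E) X x.2.proj)
      (extChartAt (phaseModel k E) x x).2.1 := by
    rw [phase_extChartAt_self]
    exact (smoothFieldAt_iff 𝓘(ℝ, E) X (mem_extChartAt_source x.2.proj)).1 (hX _)
  obtain ⟨D, hD, hD'⟩ := hasFDerivAt_completeLift_coord hX'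
  have hs := fun v w => hX'.isSymmSndFDerivAt (by simp; norm_cast) v w
  rw [e.fderiv_eq, hD.fderiv, hD', hD']
  generalize fieldInChart (phaseModel k E) Z x (extChartAt (phaseModel k E) x x) = z
  generalize fieldInChart (phaseModel k E) W x (extChartAt (phaseModel k E) x x) = w
  simp only [omegaCoord_apply, neg_apply, add_apply, ContinuousLinearMap.comp_apply, Pi.neg_apply,
    Pi.add_apply, hs z.2.1 w.2.1, fderiv_fun_const, Pi.zero_apply, zero_apply]
  ring

end CanonicalForms

/-! ### Metrics, the Killing equation and dual metrics in charts -/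

section MetricCharts

variable {E : Type*} [NormedAddCommGroup E] [NormedSpace ℝ E]
  {Q : Type*} [TopologicalSpace Q] [ChartedSpace E Q] [IsManifold 𝓘(ℝ, E) ∞ Q]

/-- The expression of a metric in the preferred chart at `q`. -/
def metricCoord (g : SemiRiemannianMetric E Q) (q : Q) (u : E) : E →L[ℝ] E →L[ℝ] ℝ :=
  (show E →L[ℝ] E →L[ℝ] ℝ from g.val ((extChartAt 𝓘(ℝ, E) q).symm u)).bilinearComp
    (dChartSymm 𝓘(ℝ, E) q u) (dChartSymm 𝓘(ℝ, E) q u)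

lemma metricCoord_apply (g : SemiRiemannianMetric E Q) (q : Q) (u v w : E) :
    metricCoord g q u v w = g.val ((extChartAt 𝓘(ℝ, E) q).symm u)
      (dChartSymm 𝓘(ℝ, E) q u v) (dChartSymm 𝓘(ℝ, E) q u w) := rfl

lemma metricCoord_symm (g : SemiRiemannianMetric E Q) (q : Q) (u v w : E) :
    metricCoord g q u v w = metricCoord g q u w v := by
  rw [metricCoord_apply, metricCoord_apply]
  exact g.symm _ _ _

lemma val_eq_metricCoord (g : SemiRiemannianMetric E Q) {q : Q} {u : E}
    (hu : u ∈ (extChartAt 𝓘(ℝ, E) q).target) (v w : E) :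
    g.val ((extChartAt 𝓘(ℝ, E) q).symm u) v w
      = metricCoord g q u (dChart 𝓘(ℝ, E) q ((extChartAt 𝓘(ℝ, E) q).symm u) v)
        (dChart 𝓘(ℝ, E) q ((extChartAt 𝓘(ℝ, E) q).symm u) w) := by
  have h := fun v => dChartSymm_dChart 𝓘(ℝ, E) ((extChartAt 𝓘(ℝ, E) q).map_target hu) v
  rw [(extChartAt 𝓘(ℝ, E) q).right_inv hu] at h
  rw [metricCoord_apply, h, h]

/-- The vector field which is constant in the preferred chart at `q`. -/
def constField (q : Q) (v : E) (y : Q) : TangentSpace 𝓘(ℝ, E) y :=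
  dChartSymm 𝓘(ℝ, E) q (extChartAt 𝓘(ℝ, E) q y) v

lemma fieldInChart_constField {q : Q} (v : E) {u : E} (hu : u ∈ (extChartAt 𝓘(ℝ, E) q).target) :
    fieldInChart 𝓘(ℝ, E) (constField q v) q u = v := by
  have h : fieldInChart 𝓘(ℝ, E) (constField q v) q u
      = dChart 𝓘(ℝ, E) q ((extChartAt 𝓘(ℝ, E) q).symm u)
        (dChartSymm 𝓘(ℝ, E) q (extChartAt 𝓘(ℝ, E) q ((extChartAt 𝓘(ℝ, E) q).symm u)) v) := rfl
  rw [h, (extChartAt 𝓘(ℝ, E) q).right_inv hu, dChart_dChartSymm 𝓘(ℝ, E) hu]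

lemma smoothFieldAt_constField {q y : Q} (v : E) (hy : y ∈ (extChartAt 𝓘(ℝ, E) q).source) :
    SmoothFieldAt 𝓘(ℝ, E) (constField q v) y := by
  rw [smoothFieldAt_iff _ _ hy]
  refine (contDiffAt_const (c := v)).congr_of_eventuallyEq ?_
  filter_upwards [extChartAt_target_mem_nhds' (I := 𝓘(ℝ, E))
    ((extChartAt 𝓘(ℝ, E) q).map_source hy)] with u hu
  exact fieldInChart_constField v hu

lemma contMDiffAt_metric_apply (g : SemiRiemannianMetric E Q)
    {Z W : Π q : Q, TangentSpace 𝓘(ℝ, E) q}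
    {q : Q} (hZ : SmoothFieldAt 𝓘(ℝ, E) Z q) (hW : SmoothFieldAt 𝓘(ℝ, E) W q) :
    ContMDiffAt 𝓘(ℝ, E) 𝓘(ℝ, ℝ) ∞ (fun y => g.val y (Z y) (W y)) q := by
  have : ContMDiffAt 𝓘(ℝ, E) (𝓘(ℝ, E).prod 𝓘(ℝ)) ∞
      (fun m ↦ TotalSpace.mk' ℝ (E := Bundle.Trivial Q ℝ) m (g.val m (Z m) (W m))) q := by
    apply ContMDiffAt.clm_bundle_apply₂ (F₁ := E) (F₂ := E)
    · exact g.contMDiff.contMDiffAt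
    · exact hZ
    · exact hW
  simp only [contMDiffAt_totalSpace] at this
  exact this.2

/-- In finite dimension, smoothness of a bilinear-form-valued map can be tested on pairs of fixed
vectors, that is, on coordinate-constant fields. -/
lemma contDiffOn_metricCoord [FiniteDimensional ℝ E] (g : SemiRiemannianMetric E Q) (q : Q) :
    ContDiffOn ℝ ∞ (metricCoord g q) (extChartAt 𝓘(ℝ, E) q).target := by
  rw [contDiffOn_clm_apply]
  intro v
  rw [contDiffOn_clm_apply]
  intro w u hu
  refine ContDiffAt.contDiffWithinAt ?_
  have hs := (extChartAt 𝓘(ℝ, E) q).map_target hu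
  have h1 := contMDiffAt_metric_apply g (smoothFieldAt_constField v hs)
    (smoothFieldAt_constField w hs)
  have h2 : ContMDiffAt 𝓘(ℝ, E) 𝓘(ℝ, E) ∞ (extChartAt 𝓘(ℝ, E) q).symm u :=
    (contMDiffOn_extChartAt_symm q).contMDiffAt (extChartAt_target_mem_nhds' hu)
  have h3 : ContDiffAt ℝ ∞ (fun u => g.val ((extChartAt 𝓘(ℝ, E) q).symm u)
      (constField q v ((extChartAt 𝓘(ℝ, E) q).symm u))
      (constField q w ((extChartAt 𝓘(ℝ, E) q).symm u))) u := (h1.comp u h2).contDiffAt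
  refine h3.congr_of_eventuallyEq ?_
  filter_upwards [extChartAt_target_mem_nhds' (I := 𝓘(ℝ, E)) hu] with u hu
  rw [metricCoord_apply]
  unfold constField
  rw [(extChartAt 𝓘(ℝ, E) q).right_inv hu]

/-- The Killing equation in a chart. -/
lemma killing_metricCoord [FiniteDimensional ℝ E] {g : SemiRiemannianMetric E Q}
    {X : Π q : Q, TangentSpace 𝓘(ℝ, E) q} (h : LieDerivTwoEqZero 𝓘(ℝ, E) X g.val)
    (q : Q) (v w : E) :
    fderiv ℝ (metricCoord g q) (extChartAt 𝓘(ℝ, E) q q)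
        (fieldInChart 𝓘(ℝ, E) X q (extChartAt 𝓘(ℝ, E) q q)) v w
      + metricCoord g q (extChartAt 𝓘(ℝ, E) q q)
        (fderiv ℝ (fieldInChart 𝓘(ℝ, E) X q) (extChartAt 𝓘(ℝ, E) q q) v) w
      + metricCoord g q (extChartAt 𝓘(ℝ, E) q q) v
        (fderiv ℝ (fieldInChart 𝓘(ℝ, E) X q) (extChartAt 𝓘(ℝ, E) q q) w) = 0 := by
  have : CompleteSpace E := FiniteDimensional.complete ℝ E
  have hs := mem_extChartAt_source (I := 𝓘(ℝ, E)) q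
  have ht := mem_extChartAt_target (I := 𝓘(ℝ, E)) q
  have hc := fun v : E => smoothFieldAt_constField v hs
  have hd := fun v : E =>
    ((smoothFieldAt_iff _ _ hs).1 (hc v)).differentiableAt (by simp)
  -- The test fields need to be smooth only at `q`, so the fields constant in the chart are
  -- admissible although nothing is known of them outside its domain.
  have h1 := h q _ _ (hc v) (hc w)
  rw [lieDerivTwo_eq 𝓘(ℝ, E) (T' := metricCoord g q) (fun u hu v w => val_eq_metricCoord g hu v w)
    (((contDiffOn_metricCoord g q).contDiffAt (extChartAt_target_mem_nhds q)).differentiableAt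
      (by simp)) (hd v) (hd w), fieldInChart_constField v ht, fieldInChart_constField w ht] at h1
  exact h1

lemma metricCoord_isInvertible [FiniteDimensional ℝ E] (g : SemiRiemannianMetric E Q) {q : Q}
    {u : E} (hu : u ∈ (extChartAt 𝓘(ℝ, E) q).target) : (metricCoord g q u).IsInvertible := by
  have hinj : Function.Injective (metricCoord g q u).toLinearMap := by
    refine (injective_iff_map_eq_zero _).2 fun v hv => ?_
    have h0 : dChartSymm 𝓘(ℝ, E) q u v = 0 := by
      refine g.nondegenerate ((extChartAt 𝓘(ℝ, E) q).symm u) _ fun w => ?_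
      have h1 := val_eq_metricCoord g hu (dChartSymm 𝓘(ℝ, E) q u v) w
      rw [dChart_dChartSymm 𝓘(ℝ, E) hu] at h1
      refine h1.trans ?_
      exact DFunLike.congr_fun hv _
    rw [← dChart_dChartSymm 𝓘(ℝ, E) hu v, h0, map_zero]
  have hdim : Module.finrank ℝ E = Module.finrank ℝ (E →L[ℝ] ℝ) := by
    rw [← LinearEquiv.finrank_eq
      (LinearMap.toContinuousLinearMap : (E →ₗ[ℝ] ℝ) ≃ₗ[ℝ] (E →L[ℝ] ℝ))]
    exact Subspace.dual_finrank_eq.symm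
  exact ⟨(LinearEquiv.ofInjectiveOfFinrankEq _ hinj hdim).toContinuousLinearEquiv, by ext; rfl⟩

/-- The dual metric in a chart. -/
lemma dual_eq_metricCoord [FiniteDimensional ℝ E] (g : SemiRiemannianMetric E Q) {q : Q}
    {u : E} (hu : u ∈ (extChartAt 𝓘(ℝ, E) q).target) (p : E →L[ℝ] ℝ) :
    g.dual ((extChartAt 𝓘(ℝ, E) q).symm u)
        (p.comp (dChart 𝓘(ℝ, E) q ((extChartAt 𝓘(ℝ, E) q).symm u)) : E →L[ℝ] ℝ)
        (p.comp (dChart 𝓘(ℝ, E) q ((extChartAt 𝓘(ℝ, E) q).symm u)) : E →L[ℝ] ℝ)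
      = p ((metricCoord g q u).inverse p) := by
  set s := (metricCoord g q u).inverse p with hs
  have hs' : metricCoord g q u s = p := by
    obtain ⟨e, he⟩ := metricCoord_isInvertible g hu
    rw [hs, ← he]; simp
  -- Raising the index commutes with the chart: the vector dual to the covector has coordinates `s =
  -- G⁻¹ p`.
  have h1 : (g.flat ((extChartAt 𝓘(ℝ, E) q).symm u)).symm
      (p.comp (dChart 𝓘(ℝ, E) q ((extChartAt 𝓘(ℝ, E) q).symm u)) : E →L[ℝ] ℝ)
      = dChartSymm 𝓘(ℝ, E) q u s := by
    refine (LinearEquiv.symm_apply_eq _).2 ?_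
    refine ContinuousLinearMap.ext fun w => ?_
    have h2 := val_eq_metricCoord g hu (dChartSymm 𝓘(ℝ, E) q u s) w
    rw [dChart_dChartSymm 𝓘(ℝ, E) hu, hs'] at h2
    exact h2.symm
  unfold SemiRiemannianMetric.dual
  rw [h1]
  refine (metricCoord_apply g q u s s).symm.trans ?_
  rw [hs']

end MetricCharts

/-! ### Invariance of the kinetic energy -/

set_option synthInstance.maxHeartbeats 200000 in
set_option maxHeartbeats 1000000 in
/-- The derivative of `p(G⁻¹ p)` vanishes along the cotangent lift of an infinitesimal isometry. -/
lemma fderiv_inverse_quadratic_eq_zero {F E : Type*} [NormedAddCommGroup F] [NormedSpace ℝ F]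
    [NormedAddCommGroup E] [NormedSpace ℝ E] [CompleteSpace E]
    {G : F → E →L[ℝ] E →L[ℝ] ℝ} {p : F → E →L[ℝ] ℝ} {u y : F}
    {G' : F →L[ℝ] E →L[ℝ] E →L[ℝ] ℝ} {p' : F →L[ℝ] E →L[ℝ] ℝ} {L : E →L[ℝ] E}
    (hG : HasFDerivAt G G' u) (hp : HasFDerivAt p p' u)
    (hinv : ∀ᶠ u in 𝓝 u, (G u).IsInvertible) (hsymm : ∀ v w, G u v w = G u w v)
    (hkill : ∀ v w, G' y v w + G u (L v) w + G u v (L w) = 0)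
    (hp' : p' y = -((p u).comp L)) :
    ∃ D : F →L[ℝ] ℝ, HasFDerivAt (fun u => p u ((G u).inverse (p u))) D u ∧ D y = 0 := by
  have hi : HasFDerivAt (fun u => (G u).inverse) _ u :=
    HasFDerivAt.comp (g := ContinuousLinearMap.inverse) u
      (((hinv.self_of_nhds.contDiffAt_map_inverse (n := 1)).differentiableAt
        one_ne_zero).hasFDerivAt) hG
  have hs := hi.clm_apply hp
  set S := fun u => (G u).inverse (p u) with hS
  obtain ⟨S', hS'⟩ : ∃ S', HasFDerivAt S S' u := ⟨_, hs⟩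
  -- Differentiating `G S = p` avoids the explicit derivative of the inverse. Evaluated on `S` along
  -- `y`, it gives `G'(S, S) + G(S', S) = -G(S, L S)`. The Killing equation gives `G'(S, S) = -2 G(L
  -- S, S)`, so `G(S, S') = G(S, L S)`, which is the opposite of `p'(S)`.
  have hGS : ∀ᶠ u in 𝓝 u, G u (S u) = p u := by
    filter_upwards [hinv] with u hu
    obtain ⟨e, he⟩ := hu
    simp only [hS]
    rw [← he]; simp
  have h1 := ((hG.clm_apply hS').congr_of_eventuallyEq
    (Filter.EventuallyEq.symm hGS)).unique hp
  have h2 := DFunLike.congr_fun (DFunLike.congr_fun h1 y) (S u)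
  refine ⟨_, hp.clm_apply hS', ?_⟩
  have h3 : p u = G u (S u) := hGS.self_of_nhds.symm
  have h4 := hkill (S u) (S u)
  have h0 : (G u).inverse (p u) = S u := rfl
  simp only [h0, add_apply, ContinuousLinearMap.comp_apply, ContinuousLinearMap.flip_apply, hp',
    neg_apply] at h2 ⊢
  rw [h3] at h2 ⊢
  have h5 := hsymm (S' y) (S u)
  have h6 := hsymm (L (S u)) (S u)
  linarith

/-! ### Invariance of the Hamiltonian and Noether's theorem -/

section Noether

set_option synthInstance.maxHeartbeats 200000

variable {k : ℕ} {E : Type*} [NormedAddCommGroup E] [NormedSpace ℝ E]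
  {Q : Type*} [TopologicalSpace Q] [ChartedSpace E Q] [IsManifold 𝓘(ℝ, E) ∞ Q]

lemma dChart_self_completeLift (X : Π q : Q, TangentSpace 𝓘(ℝ, E) q) (x : PhaseSpace k E Q) :
    dChart (phaseModel k E) x x (completeLift X x) =
      (0, fieldInChart 𝓘(ℝ, E) X x.2.proj (extChartAt 𝓘(ℝ, E) x.2.proj x.2.proj),
        -((momentum x).comp (fderiv ℝ (fieldInChart 𝓘(ℝ, E) X x.2.proj)
          (extChartAt 𝓘(ℝ, E) x.2.proj x.2.proj)))) := by
  rw [dChart_self]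
  refine (completeLift_eq X x).trans ?_
  rw [fieldInChart_eq, extChartAt_to_inv, dChart_self]
  rfl

lemma etaForm_eq (A : Fin k) (x : PhaseSpace k E Q)
    (v : (Fin k → ℝ) × E × (E →L[ℝ] (Fin k → ℝ))) : etaForm A x v = v.1 A := by
  have h : etaForm A x v = fderiv ℝ
      (fun u => ((extChartAt (phaseModel k E) x).symm u).1 A) (extChartAt (phaseModel k E) x x)
      (dChart (phaseModel k E) x x v) := mvfderiv_eq_fderiv_chart (phaseModel k E) _ x v
  have e : (fun u => ((extChartAt (phaseModel k E) x).symm u).1 A)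
      =ᶠ[𝓝 (extChartAt (phaseModel k E) x x)]
        fun u : (Fin k → ℝ) × E × (E →L[ℝ] (Fin k → ℝ)) => u.1 A := by
    filter_upwards [extChartAt_target_mem_nhds (I := phaseModel k E) x] with u hu
    rw [phase_extChartAt_symm (mem_phase_target.1 hu)]
    rfl
  have hd : HasFDerivAt (fun u : (Fin k → ℝ) × E × (E →L[ℝ] (Fin k → ℝ)) => u.1 A) _
      (extChartAt (phaseModel k E) x x) :=
    ((ContinuousLinearMap.proj (R := ℝ) (φ := fun _ : Fin k => ℝ) A).comp
      (ContinuousLinearMap.fst ℝ (Fin k → ℝ) (E × (E →L[ℝ] (Fin k → ℝ))))).hasFDerivAt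
  rw [h, e.fderiv_eq, hd.fderiv, dChart_self]
  rfl

lemma etaForm_completeLift (X : Π q : Q, TangentSpace 𝓘(ℝ, E) q) (A : Fin k)
    (x : PhaseSpace k E Q) : etaForm A x (completeLift X x) = 0 := by
  refine (etaForm_eq A x _).trans ?_
  rw [completeLift_eq]
  rfl

omit [IsManifold 𝓘(ℝ, E) ∞ Q] in
lemma covector_mkPhase_comp (t : Fin k → ℝ) (q : Q) (p : E →L[ℝ] (Fin k → ℝ)) (d : E →L[ℝ] E)
    (A : Fin k) : covector (mkPhase t q (p.comp d)) A
      = (((ContinuousLinearMap.proj (R := ℝ) (φ := fun _ : Fin k => ℝ) A).comp p).comp d :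
        E →L[ℝ] ℝ) := rfl

lemma quadraticHamiltonian_chart [FiniteDimensional ℝ E] (g : Fin k → SemiRiemannianMetric E Q)
    (V : (Fin k → ℝ) × Q → ℝ) {x : PhaseSpace k E Q}
    {u : (Fin k → ℝ) × E × (E →L[ℝ] (Fin k → ℝ))}
    (hu : u ∈ (extChartAt (phaseModel k E) x).target) :
    quadraticHamiltonian g V ((extChartAt (phaseModel k E) x).symm u) =
      (1 / 2) * ∑ A, ((ContinuousLinearMap.proj (R := ℝ) (φ := fun _ : Fin k => ℝ) A).comp u.2.2)
        ((metricCoord (g A) x.2.proj u.2.1).inverse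
          ((ContinuousLinearMap.proj (R := ℝ) (φ := fun _ : Fin k => ℝ) A).comp u.2.2))
      + V (u.1, (extChartAt 𝓘(ℝ, E) x.2.proj).symm u.2.1) := by
  have hu' := mem_phase_target.1 hu
  rw [phase_extChartAt_symm hu']
  have h : ∀ A, (g A).dual ((extChartAt 𝓘(ℝ, E) x.2.proj).symm u.2.1)
      (covector (mkPhase u.1 ((extChartAt 𝓘(ℝ, E) x.2.proj).symm u.2.1)
        (u.2.2.comp (dChart 𝓘(ℝ, E) x.2.proj ((extChartAt 𝓘(ℝ, E) x.2.proj).symm u.2.1)))) A)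
      (covector (mkPhase u.1 ((extChartAt 𝓘(ℝ, E) x.2.proj).symm u.2.1)
        (u.2.2.comp (dChart 𝓘(ℝ, E) x.2.proj ((extChartAt 𝓘(ℝ, E) x.2.proj).symm u.2.1)))) A) = _ :=
    fun A => (congrArg (fun c => (g A).dual _ c c) (covector_mkPhase_comp _ _ _ _ A)).trans
      (dual_eq_metricCoord (g A) hu'
        ((ContinuousLinearMap.proj (R := ℝ) (φ := fun _ : Fin k => ℝ) A).comp u.2.2))
  exact congrArg (fun s => (1 / 2) * s + V (u.1, (extChartAt 𝓘(ℝ, E) x.2.proj).symm u.2.1))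
    (Finset.sum_congr rfl fun A _ => h A)

omit [IsManifold 𝓘(ℝ, E) ∞ Q] in
lemma extendField_eq (X : Π q : Q, TangentSpace 𝓘(ℝ, E) q) (p : (Fin k → ℝ) × Q) :
    extendField X p = ((0, X p.2) : (Fin k → ℝ) × E) := by
  unfold extendField
  rw [mfderiv_prod_right]
  rfl

/-- The preferred chart of `ℝ^k × Q` is the product chart, so `X(V) = 0` at `(t, q)` is already the
coordinate statement. -/
lemma fderiv_potential_chart {V : (Fin k → ℝ) × Q → ℝ}
    {X : Π q : Q, TangentSpace 𝓘(ℝ, E) q}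
    (hV : ContMDiff (configModel k E) 𝓘(ℝ, ℝ) ∞ V)
    (hXV : ∀ p : (Fin k → ℝ) × Q, mvfderiv (configModel k E) V p (extendField X p) = 0)
    (t : Fin k → ℝ) (q : Q) :
    ∃ D : ((Fin k → ℝ) × E) →L[ℝ] ℝ,
      HasFDerivAt (fun u : (Fin k → ℝ) × E => V (u.1, (extChartAt 𝓘(ℝ, E) q).symm u.2)) D
        (t, extChartAt 𝓘(ℝ, E) q q) ∧
      D (0, fieldInChart 𝓘(ℝ, E) X q (extChartAt 𝓘(ℝ, E) q q)) = 0 := by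
  have h1 := (hXV (t, q)).symm.trans
    (mvfderiv_eq_fderiv_chart (configModel k E) V (t, q) (extendField X (t, q)))
  rw [dChart_self] at h1
  have h2 : ContMDiffAt 𝓘(ℝ, (Fin k → ℝ) × E) (configModel k E) ∞
      (extChartAt (configModel k E) (t, q)).symm (extChartAt (configModel k E) (t, q) (t, q)) :=
    (contMDiffOn_extChartAt_symm (t, q)).contMDiffAt (extChartAt_target_mem_nhds (t, q))
  have h3 : DifferentiableAt ℝ (fun u => V ((extChartAt (configModel k E) (t, q)).symm u))
      (extChartAt (configModel k E) (t, q) (t, q)) :=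
    ((hV.contMDiffAt.comp _ h2).contDiffAt).differentiableAt (by simp)
  refine ⟨_, h3.hasFDerivAt, ?_⟩
  refine Eq.trans ?_ h1.symm
  refine congrArg (fderiv ℝ (fun u => V ((extChartAt (configModel k E) (t, q)).symm u))
      (extChartAt (configModel k E) (t, q) (t, q))) ?_
  refine Eq.trans ?_ (extendField_eq X (t, q)).symm
  rw [fieldInChart_eq, extChartAt_to_inv, dChart_self]
  rfl

/-- Each kinetic term is `p^A(G_A⁻¹ p^A)`, and `fderiv_inverse_quadratic_eq_zero` applies with `L =
DX`: the momentum part `-p ∘ DX` of the lift is exactly the variation of `p` it asks for, and its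
infinitesimal isometry condition is `killing_metricCoord`. -/
lemma mvfderiv_quadraticHamiltonian_completeLift [FiniteDimensional ℝ E]
    {g : Fin k → SemiRiemannianMetric E Q} {V : (Fin k → ℝ) × Q → ℝ}
    (hV : ContMDiff (configModel k E) 𝓘(ℝ, ℝ) ∞ V)
    {X : Π q : Q, TangentSpace 𝓘(ℝ, E) q}
    (hKilling : ∀ A : Fin k, LieDerivTwoEqZero 𝓘(ℝ, E) X (g A).val)
    (hXV : ∀ p : (Fin k → ℝ) × Q, mvfderiv (configModel k E) V p (extendField X p) = 0)
    (x : PhaseSpace k E Q) :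
    mvfderiv (phaseModel k E) (quadraticHamiltonian g V) x (completeLift X x) = 0 := by
  have : CompleteSpace E := FiniteDimensional.complete ℝ E
  have h0 := mvfderiv_eq_fderiv_chart (phaseModel k E) (quadraticHamiltonian g V) x
    (completeLift X x)
  rw [dChart_self_completeLift] at h0
  refine h0.trans ?_
  have e : (fun u => quadraticHamiltonian g V ((extChartAt (phaseModel k E) x).symm u))
      =ᶠ[𝓝 (extChartAt (phaseModel k E) x x)] fun u =>
      (1 / 2) * ∑ A, ((ContinuousLinearMap.proj (R := ℝ) (φ := fun _ : Fin k => ℝ) A).comp u.2.2)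
        ((metricCoord (g A) x.2.proj u.2.1).inverse
          ((ContinuousLinearMap.proj (R := ℝ) (φ := fun _ : Fin k => ℝ) A).comp u.2.2))
      + V (u.1, (extChartAt 𝓘(ℝ, E) x.2.proj).symm u.2.1) := by
    filter_upwards [extChartAt_target_mem_nhds (I := phaseModel k E) x] with u hu
    exact quadraticHamiltonian_chart g V hu
  set u₀ := extChartAt (phaseModel k E) x x with hu₀
  have hu₀' : u₀ = (x.1, extChartAt 𝓘(ℝ, E) x.2.proj x.2.proj, momentum x) :=
    phase_extChartAt_self x
  have ht : u₀.2.1 ∈ (extChartAt 𝓘(ℝ, E) x.2.proj).target :=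
    mem_phase_target.1 (mem_extChartAt_target x)
  obtain ⟨DV, hDV, hDV'⟩ := fderiv_potential_chart hV hXV x.1 x.2.proj
  have p1 := hasFDerivAt_phase_fst u₀
  have p2 := hasFDerivAt_phase_snd u₀
  have p0 : HasFDerivAt (𝕜 := ℝ) (fun u : (Fin k → ℝ) × E × (E →L[ℝ] (Fin k → ℝ)) => u.1) _ u₀ :=
    hasFDerivAt_fst (𝕜 := ℝ)
  have hVd := HasFDerivAt.comp (f := fun u : (Fin k → ℝ) × E × (E →L[ℝ] (Fin k → ℝ)) =>
    (u.1, u.2.1)) (g := fun u : (Fin k → ℝ) × E => V (u.1, (extChartAt 𝓘(ℝ, E) x.2.proj).symm u.2))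
    u₀ (by rw [hu₀']; exact hDV) (p0.prodMk p1)
  have hK : ∀ A : Fin k, ∃ D : ((Fin k → ℝ) × E × (E →L[ℝ] (Fin k → ℝ))) →L[ℝ] ℝ,
      HasFDerivAt (fun u : (Fin k → ℝ) × E × (E →L[ℝ] (Fin k → ℝ)) =>
        ((ContinuousLinearMap.proj (R := ℝ) (φ := fun _ : Fin k => ℝ) A).comp u.2.2)
        ((metricCoord (g A) x.2.proj u.2.1).inverse
          ((ContinuousLinearMap.proj (R := ℝ) (φ := fun _ : Fin k => ℝ) A).comp u.2.2))) D u₀ ∧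
      D (0, fieldInChart 𝓘(ℝ, E) X x.2.proj (extChartAt 𝓘(ℝ, E) x.2.proj x.2.proj),
        -((momentum x).comp (fderiv ℝ (fieldInChart 𝓘(ℝ, E) X x.2.proj)
          (extChartAt 𝓘(ℝ, E) x.2.proj x.2.proj)))) = 0 := by
    intro A
    have hG0 := (((contDiffOn_metricCoord (g A) x.2.proj).contDiffAt
      (extChartAt_target_mem_nhds' ht)).differentiableAt (by simp)).hasFDerivAt
    have hG := HasFDerivAt.comp (g := metricCoord (g A) x.2.proj) u₀ hG0 p1
    have hp := (hasFDerivAt_const (ContinuousLinearMap.proj (R := ℝ) (φ := fun _ : Fin k => ℝ) A)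
      u₀).clm_comp p2
    refine fderiv_inverse_quadratic_eq_zero (L := fderiv ℝ (fieldInChart 𝓘(ℝ, E) X x.2.proj)
          (extChartAt 𝓘(ℝ, E) x.2.proj x.2.proj)) hG hp ?_ ?_ ?_ ?_
    · have := p1.continuousAt.eventually_mem (extChartAt_target_mem_nhds' ht)
      filter_upwards [this] with u hu
      exact metricCoord_isInvertible (g A) hu
    · intro v w; exact metricCoord_symm _ _ _ _ _
    · intro v w
      have := killing_metricCoord (hKilling A) x.2.proj v w
      rw [hu₀']
      exact this
    · rw [hu₀']
      ext w
      simp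
  choose D hD hD' using hK
  have hH := ((HasFDerivAt.fun_sum (u := Finset.univ) fun A _ => hD A).const_mul (1 / 2)).add hVd
  have hH' := hH.congr_of_eventuallyEq e
  rw [hH'.fderiv]
  simp only [add_apply, smul_apply, sum_apply, hD', ContinuousLinearMap.comp_apply]
  simpa using hDV'

lemma covector_apply_chart (X : Π q : Q, TangentSpace 𝓘(ℝ, E) q) (A : Fin k)
    {x : PhaseSpace k E Q} {u : (Fin k → ℝ) × E × (E →L[ℝ] (Fin k → ℝ))}
    (hu : u ∈ (extChartAt (phaseModel k E) x).target) :
    covector ((extChartAt (phaseModel k E) x).symm u) A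
      (X ((extChartAt (phaseModel k E) x).symm u).2.proj)
      = u.2.2 (fieldInChart 𝓘(ℝ, E) X x.2.proj u.2.1) A := by
  rw [phase_extChartAt_symm (mem_phase_target.1 hu)]
  rfl

lemma hasFDerivAt_covector_coord {X' : E → E} {u : (Fin k → ℝ) × E × (E →L[ℝ] (Fin k → ℝ))}
    (A : Fin k) (hX : DifferentiableAt ℝ X' u.2.1) :
    ∃ D : ((Fin k → ℝ) × E × (E →L[ℝ] (Fin k → ℝ))) →L[ℝ] ℝ,
      HasFDerivAt (fun u : (Fin k → ℝ) × E × (E →L[ℝ] (Fin k → ℝ)) => u.2.2 (X' u.2.1) A) D u ∧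
      ∀ v, D v = v.2.2 (X' u.2.1) A + u.2.2 (fderiv ℝ X' u.2.1 v.2.1) A := by
  have p1 := HasFDerivAt.comp (g := X') u hX.hasFDerivAt (hasFDerivAt_phase_fst u)
  have hd := hasFDerivAt_pi'.1 ((hasFDerivAt_phase_snd u).clm_apply p1) A
  refine ⟨_, hd, fun v => ?_⟩
  simp [add_comm]

/-- The differential of `x ↦ α^A(X)` is `i_{X^{1*}} ω^A`. -/
lemma mvfderiv_covector_apply {X : Π q : Q, TangentSpace 𝓘(ℝ, E) q}
    (hX : SmoothField 𝓘(ℝ, E) X) (A : Fin k) (x : PhaseSpace k E Q)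
    (v : (Fin k → ℝ) × E × (E →L[ℝ] (Fin k → ℝ))) :
    mvfderiv (phaseModel k E) (fun x : PhaseSpace k E Q => covector x A (X x.2.proj)) x v
      = -omegaForm A x v (completeLift X x) := by
  have h0 := mvfderiv_eq_fderiv_chart (phaseModel k E)
    (fun x : PhaseSpace k E Q => covector x A (X x.2.proj)) x v
  rw [dChart_self] at h0
  refine h0.trans ?_
  have hX' : ContDiffAt ℝ ∞ (fieldInChart 𝓘(ℝ, E) X x.2.proj)
      (extChartAt (phaseModel k E) x x).2.1 := by
    rw [phase_extChartAt_self]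
    exact (smoothFieldAt_iff 𝓘(ℝ, E) X (mem_extChartAt_source x.2.proj)).1 (hX _)
  have e : (fun u => covector ((extChartAt (phaseModel k E) x).symm u) A
      (X ((extChartAt (phaseModel k E) x).symm u).2.proj))
      =ᶠ[𝓝 (extChartAt (phaseModel k E) x x)] fun u =>
        u.2.2 (fieldInChart 𝓘(ℝ, E) X x.2.proj u.2.1) A := by
    filter_upwards [extChartAt_target_mem_nhds (I := phaseModel k E) x] with u hu
    exact covector_apply_chart X A hu
  obtain ⟨D, hD, hD'⟩ := hasFDerivAt_covector_coord A (hX'.differentiableAt (by simp))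
  rw [e.fderiv_eq, hD.fderiv]
  refine (hD' v).trans ?_
  refine Eq.trans ?_ (congrArg Neg.neg (omegaForm_eq A x v (completeLift X x))).symm
  have h2 := dChart_self_completeLift X x
  rw [dChart_self] at h2
  refine Eq.trans ?_ (congrArg (fun w => -omegaCoord A v w) h2).symm
  rw [omegaCoord_apply, phase_extChartAt_self]
  simp only [neg_apply, ContinuousLinearMap.comp_apply, Pi.neg_apply]
  ring

lemma contMDiff_covector_apply {X : Π q : Q, TangentSpace 𝓘(ℝ, E) q}
    (hX : SmoothField 𝓘(ℝ, E) X) (A : Fin k) :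
    ContMDiff (phaseModel k E) 𝓘(ℝ, ℝ) ∞
      (fun x : PhaseSpace k E Q => covector x A (X x.2.proj)) := by
  intro x
  have hX' : ContDiffAt ℝ ∞ (fieldInChart 𝓘(ℝ, E) X x.2.proj)
      (extChartAt (phaseModel k E) x x).2.1 := by
    rw [phase_extChartAt_self]
    exact (smoothFieldAt_iff 𝓘(ℝ, E) X (mem_extChartAt_source x.2.proj)).1 (hX _)
  have p1 : ContDiffAt ℝ ∞ (fun u : (Fin k → ℝ) × E × (E →L[ℝ] (Fin k → ℝ)) => u.2.1)
      (extChartAt (phaseModel k E) x x) := contDiffAt_snd.fst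
  have p2 : ContDiffAt ℝ ∞ (fun u : (Fin k → ℝ) × E × (E →L[ℝ] (Fin k → ℝ)) => u.2.2)
      (extChartAt (phaseModel k E) x x) := contDiffAt_snd.snd
  have h1 := p2.clm_apply (ContDiffAt.comp (g := fieldInChart 𝓘(ℝ, E) X x.2.proj)
    (extChartAt (phaseModel k E) x x) hX' p1)
  have h2 := contDiffAt_pi.1 h1 A
  refine (h2.contMDiffAt.comp x contMDiffAt_extChartAt).congr_of_eventuallyEq ?_
  filter_upwards [extChartAt_source_mem_nhds (I := phaseModel k E) x] with y hy
  have h3 := covector_apply_chart X A ((extChartAt (phaseModel k E) x).map_source hy)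
  rw [(extChartAt (phaseModel k E) x).left_inv hy] at h3
  exact h3

/-- Noether's theorem for complete lifts. -/
lemma isConservationLaw_of_completeLift {H : PhaseSpace k E Q → ℝ}
    {X : Π q : Q, TangentSpace 𝓘(ℝ, E) q} (hX : SmoothField 𝓘(ℝ, E) X)
    (hH : ∀ x : PhaseSpace k E Q, mvfderiv (phaseModel k E) H x (completeLift X x) = 0) :
    IsConservationLaw H (fun x A => covector x A (X x.2.proj)) := by
  refine ⟨?_, ?_⟩
  · intro x
    exact contMDiffAt_pi_space.2 fun A => contMDiff_covector_apply hX A x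
  · intro U ψ hψ t ht
    -- The field equations are tested on the symmetry itself: the left side becomes minus the
    -- divergence, and both terms on the right vanish.
    have h1 := hψ.equation t ht (completeLift X (ψ t))
    have hψd : MDifferentiableAt 𝓘(ℝ, Fin k → ℝ) (phaseModel k E) ψ t :=
      ((hψ.smooth.contMDiffAt (hψ.isOpen.mem_nhds ht)).mdifferentiableAt (by simp))
    have h2 : ∀ A : Fin k, fderiv ℝ (fun s => covector (ψ s) A (X (ψ s).2.proj)) t (Pi.single A 1)
        = -omegaForm A (ψ t) (mfderiv 𝓘(ℝ, Fin k → ℝ) (phaseModel k E) ψ t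
          (Pi.single A (1 : ℝ) : Fin k → ℝ)) (completeLift X (ψ t)) := by
      intro A
      refine Eq.trans ?_ (mvfderiv_covector_apply hX A (ψ t) _)
      have hF := ((contMDiff_covector_apply hX A).mdifferentiable (by simp) (ψ t)).hasMFDerivAt
      have hFψ : HasFDerivAt (fun s => covector (ψ s) A (X (ψ s).2.proj))
          ((show ((Fin k → ℝ) × E × (E →L[ℝ] (Fin k → ℝ))) →L[ℝ] ℝ from mvfderiv (phaseModel k E)
              (fun x : PhaseSpace k E Q => covector x A (X x.2.proj)) (ψ t)).comp
            (show (Fin k → ℝ) →L[ℝ] ((Fin k → ℝ) × E × (E →L[ℝ] (Fin k → ℝ))) from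
              mfderiv 𝓘(ℝ, Fin k → ℝ) (phaseModel k E) ψ t)) t :=
        (hF.comp t hψd.hasMFDerivAt).hasFDerivAt
      rw [hFψ.fderiv]
      rfl
    have h3 : ∀ A, etaForm A (ψ t) (completeLift X (ψ t)) = 0 :=
      fun A => etaForm_completeLift X A (ψ t)
    have h4 : ∑ A, omegaForm A (ψ t) (mfderiv 𝓘(ℝ, Fin k → ℝ) (phaseModel k E) ψ t
          (Pi.single A (1 : ℝ) : Fin k → ℝ)) (completeLift X (ψ t)) = 0 := by
      refine h1.trans ?_
      rw [hH]
      simp only [h3, mul_zero, Finset.sum_const_zero, sub_zero]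
    refine (Finset.sum_congr rfl fun A _ => h2 A).trans ?_
    rw [Finset.sum_neg_distrib, h4, neg_zero]

end Noether

/-! ### Derivatives of one-parameter families of maps -/

section FlowCalculus

variable {F F' : Type*} [NormedAddCommGroup F] [NormedSpace ℝ F]
  [NormedAddCommGroup F'] [NormedSpace ℝ F']

/-- The spatial derivative of a smooth family of maps evolves by the derivative of its generator. -/
lemma hasDerivAt_fderiv_of_hasDerivAt {f : ℝ × F → F'} {Z : F → F'} {z : F}
    (hf : ContDiffAt ℝ ∞ f (0, z))
    (hZ : ∀ᶠ y in 𝓝 z, HasDerivAt (fun s => f (s, y)) (Z y) 0) :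
    HasDerivAt (fun s => fderiv ℝ (fun y => f (s, y)) z) (fderiv ℝ Z z) 0 := by
  -- Being `C^∞` at a point need not spread to a neighbourhood, whereas being `C^1` does; hence the
  -- lowered order.
  have hd : ∀ᶠ w in 𝓝 ((0 : ℝ), z), DifferentiableAt ℝ f w := by
    filter_upwards [(hf.of_le (m := 1) (by norm_cast)).eventually (by simp)] with w hw
    exact hw.differentiableAt one_ne_zero
  have hcs : Filter.Tendsto (fun s : ℝ => (s, z)) (𝓝 0) (𝓝 (0, z)) :=
    (Continuous.prodMk_left z).tendsto 0
  have hcz : Filter.Tendsto (fun y : F => ((0 : ℝ), y)) (𝓝 z) (𝓝 (0, z)) :=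
    (Continuous.prodMk_right (0 : ℝ)).tendsto z
  have h2 : HasFDerivAt (fderiv ℝ f) (fderiv ℝ (fderiv ℝ f) (0, z)) (0, z) :=
    ((hf.fderiv_right (m := 1) (by norm_cast)).differentiableAt one_ne_zero).hasFDerivAt
  -- Both sides are mixed second derivatives of `f` at `(0, z)`, time then space against space then
  -- time.
  have hsymm := hf.isSymmSndFDerivAt (by simp; norm_cast)
  have e1 : (fun s => fderiv ℝ (fun y => f (s, y)) z)
      =ᶠ[𝓝 0] fun s => (fderiv ℝ f (s, z)).comp (ContinuousLinearMap.inr ℝ ℝ F) := by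
    filter_upwards [hcs.eventually hd] with s hs
    exact (HasFDerivAt.comp (g := f) z hs.hasFDerivAt (hasFDerivAt_prodMk_right s z)).fderiv
  have e2 : Z =ᶠ[𝓝 z] fun y => fderiv ℝ f (0, y) (1, 0) := by
    filter_upwards [hcz.eventually hd, hZ] with y hy hZy
    have h := HasFDerivAt.comp_hasDerivAt (l := f) (f := fun s : ℝ => (s, y)) 0 hy.hasFDerivAt
      ((hasDerivAt_id' (0 : ℝ)).prodMk (hasDerivAt_const (0 : ℝ) y))
    exact hZy.unique h
  have h3 : HasFDerivAt (fun y => fderiv ℝ f (0, y) (1, 0)) _ z :=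
    (HasFDerivAt.comp (g := fderiv ℝ f) z h2 (hasFDerivAt_prodMk_right (0 : ℝ) z)).clm_apply
      (hasFDerivAt_const ((1 : ℝ), (0 : F)) z)
  have h4 : HasDerivAt (fun s => fderiv ℝ f (s, z)) (fderiv ℝ (fderiv ℝ f) (0, z) (1, 0)) 0 :=
    HasFDerivAt.comp_hasDerivAt (l := fderiv ℝ f) (f := fun s : ℝ => (s, z)) 0 h2
      ((hasDerivAt_id' (0 : ℝ)).prodMk (hasDerivAt_const (0 : ℝ) z))
  have h5 := (h4.clm_comp (hasDerivAt_const (0 : ℝ) (ContinuousLinearMap.inr ℝ ℝ F)))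
  refine (h5.congr_of_eventuallyEq e1).congr_deriv ?_
  rw [e2.fderiv_eq, h3.fderiv]
  ext v
  simp
  exact hsymm _ _

set_option synthInstance.maxHeartbeats 200000 in
lemma hasDerivAt_ringInverse_of_eq_one {A : Type*} [NormedRing A] [NormedAlgebra ℝ A]
    [CompleteSpace A] {R : ℝ → A} {D : A} (hR : HasDerivAt R D 0) (hR0 : R 0 = 1) :
    HasDerivAt (fun s => Ring.inverse (R s)) (-D) 0 := by
  have hi := hasFDerivAt_ringInverse (𝕜 := ℝ) (1 : Aˣ)
  rw [Units.val_one, ← hR0] at hi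
  refine (HasFDerivAt.comp_hasDerivAt (0 : ℝ) hi hR).congr_deriv ?_
  simp

/-- `ContinuousLinearMap.inverse` on endomorphisms is the ring inverse, whose derivative at 1 is
minus the identity. Invertibility need only be known at `s = 0`. -/
lemma hasDerivAt_inverse_of_eq_id [CompleteSpace F] {R : ℝ → F →L[ℝ] F} {D : F →L[ℝ] F}
    (hR : HasDerivAt R D 0) (hR0 : R 0 = ContinuousLinearMap.id ℝ F) :
    HasDerivAt (fun s => (R s).inverse) (-D) 0 := by
  have h := hasDerivAt_ringInverse_of_eq_one hR hR0
  rwa [ContinuousLinearMap.ringInverse_eq_inverse] at h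

lemma hasDerivAt_comp_inverse_of_eq_id [CompleteSpace F] {N : ℝ → F →L[ℝ] F'}
    {R : ℝ → F →L[ℝ] F} {D : F →L[ℝ] F} (hN : HasDerivAt N 0 0) (hR : HasDerivAt R D 0)
    (hR0 : R 0 = ContinuousLinearMap.id ℝ F) :
    HasDerivAt (fun s => (N s).comp (R s).inverse) (-((N 0).comp D)) 0 := by
  refine (hN.clm_comp (hasDerivAt_inverse_of_eq_id hR hR0)).congr_deriv ?_
  ext v
  simp

/-- The derivative of the cotangent action of a one-parameter family `L` of linear maps with
`L 0 = id`. -/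
lemma hasDerivAt_prolong_coord [CompleteSpace F] {L : ℝ → (F' × F) →L[ℝ] (F' × F)}
    {L' : (F' × F) →L[ℝ] (F' × F)} {D : F →L[ℝ] F} (α : F →L[ℝ] F')
    (hL : HasDerivAt L L' 0) (h0 : L 0 = ContinuousLinearMap.id ℝ _)
    (hL' : ∀ v, L' v = (0, D v.2)) :
    HasDerivAt (fun s => (((ContinuousLinearMap.fst ℝ F' F).comp
          ((L s).comp (ContinuousLinearMap.inr ℝ F' F)))
        + (((ContinuousLinearMap.fst ℝ F' F).comp
          ((L s).comp (ContinuousLinearMap.inl ℝ F' F))).comp α)).comp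
      ((ContinuousLinearMap.snd ℝ F' F).comp
          ((L s).comp (ContinuousLinearMap.inr ℝ F' F))).inverse) (-(α.comp D)) 0 := by
  have hfst := hasDerivAt_const (0 : ℝ) (ContinuousLinearMap.fst ℝ F' F)
  have hsnd := hasDerivAt_const (0 : ℝ) (ContinuousLinearMap.snd ℝ F' F)
  have hinl := hasDerivAt_const (0 : ℝ) (ContinuousLinearMap.inl ℝ F' F)
  have hinr := hasDerivAt_const (0 : ℝ) (ContinuousLinearMap.inr ℝ F' F)
  -- The generator has no time component, so `dq + dt ∘ α` is stationary at `s = 0` and only the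
  -- inverse factor contributes.
  have hN : HasDerivAt (fun s => ((ContinuousLinearMap.fst ℝ F' F).comp
          ((L s).comp (ContinuousLinearMap.inr ℝ F' F)))
        + (((ContinuousLinearMap.fst ℝ F' F).comp
          ((L s).comp (ContinuousLinearMap.inl ℝ F' F))).comp α)) 0 0 := by
    refine ((hfst.clm_comp (hL.clm_comp hinr)).add
      ((hfst.clm_comp (hL.clm_comp hinl)).clm_comp (hasDerivAt_const (0 : ℝ) α))).congr_deriv ?_
    ext v
    simp [hL']
  have hR : HasDerivAt (fun s => (ContinuousLinearMap.snd ℝ F' F).comp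
          ((L s).comp (ContinuousLinearMap.inr ℝ F' F))) D 0 := by
    refine (hsnd.clm_comp (hL.clm_comp hinr)).congr_deriv ?_
    ext v
    simp [hL']
  refine (hasDerivAt_comp_inverse_of_eq_id hN hR ?_).congr_deriv ?_
  · rw [h0]; ext v; simp
  · rw [h0]; ext v; simp

end FlowCalculus

/-! ### Velocity of a curve from its coordinates -/

section CurveInChart

variable {EM : Type*} [NormedAddCommGroup EM] [NormedSpace ℝ EM]
  {HM : Type*} [TopologicalSpace HM] (I : ModelWithCorners ℝ EM HM) [I.Boundaryless]
  {M : Type*} [TopologicalSpace M] [ChartedSpace HM M]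

/-- Near time 0 the curve is the inverse chart composed with its coordinates, which gives continuity
as well as the velocity. The velocity is stated as `Y (γ 0)` so that it lies in the right fibre
without transport along `h0`. -/
lemma hasMFDerivAt_curve_of_chart [IsManifold I 1 M] {γ : ℝ → M} {x : M} {v : EM}
    (Y : Π x : M, TangentSpace I x) (h0 : γ 0 = x)
    (hs : ∀ᶠ s in 𝓝 0, γ s ∈ (extChartAt I x).source)
    (h : HasDerivAt (fun s => extChartAt I x (γ s)) v 0) (hY : dChart I x x (Y x) = v) :
    HasMFDerivAt 𝓘(ℝ, ℝ) I γ 0 ((1 : ℝ →L[ℝ] ℝ).smulRight (Y (γ 0))) := by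
  subst h0
  have h1 := (mdifferentiableAt_extChartAt_symm' I (mem_extChartAt_target (γ 0))).hasMFDerivAt
  have h2 := HasMFDerivAt.comp (0 : ℝ) h1 h.hasFDerivAt.hasMFDerivAt
  have e : γ =ᶠ[𝓝 0] (extChartAt I (γ 0)).symm ∘ fun s => extChartAt I (γ 0) (γ s) := by
    filter_upwards [hs] with s hs
    exact ((extChartAt I (γ 0)).left_inv hs).symm
  have h3 := h2.congr_of_eventuallyEq e
  have h4 : (dChartSymm I (γ 0) (extChartAt I (γ 0) (γ 0))).comp
      ((ContinuousLinearMap.toSpanSingleton ℝ v) : ℝ →L[ℝ] EM)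
      = (1 : ℝ →L[ℝ] ℝ).smulRight (Y (γ 0) : EM) := by
    rw [dChartSymm_self, ← hY, dChart_self]
    refine ContinuousLinearMap.ext_ring ?_
    rfl
  exact h4 ▸ h3

end CurveInChart

/-! ### Local flows in a chart -/

section FlowInChart

variable {EM : Type*} [NormedAddCommGroup EM] [NormedSpace ℝ EM]
  {HM : Type*} [TopologicalSpace HM] (I : ModelWithCorners ℝ EM HM)
  {M : Type*} [TopologicalSpace M] [ChartedSpace HM M]

/-- The expression of a local flow in the preferred chart at `p`. -/
def flowCoord (φ : ℝ → M → M) (p : M) (w : ℝ × EM) : EM :=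
  extChartAt I p (φ w.1 ((extChartAt I p).symm w.2))

variable [I.Boundaryless] {Z : Π x : M, TangentSpace I x} {p : M} {φ : ℝ → M → M}

omit [I.Boundaryless] in
lemma IsLocalFlow.zero_apply [IsManifold I 1 M] (h : IsLocalFlow I Z p φ) : φ 0 p = p :=
  h.zero.self_of_nhds

lemma IsLocalFlow.contDiffAt_flowCoord [IsManifold I ∞ M] [IsManifold I 1 M]
    (h : IsLocalFlow I Z p φ) : ContDiffAt ℝ ∞ (flowCoord I φ p) (0, extChartAt I p p) := by
  have hs : ContMDiffAt 𝓘(ℝ, EM) I ∞ (extChartAt I p).symm (extChartAt I p p) :=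
    (contMDiffOn_extChartAt_symm p).contMDiffAt (extChartAt_target_mem_nhds p)
  have h1 : ContMDiffAt 𝓘(ℝ, ℝ × EM) (𝓘(ℝ, ℝ).prod I) ∞
      (fun w : ℝ × EM => (w.1, (extChartAt I p).symm w.2)) (0, extChartAt I p p) := by
    refine ContMDiffAt.prodMk ?_ ?_
    · exact contDiffAt_fst.contMDiffAt
    · exact ContMDiffAt.comp (g := (extChartAt I p).symm) (0, extChartAt I p p) hs
        contDiffAt_snd.contMDiffAt
  have h2 : ContMDiffAt (𝓘(ℝ, ℝ).prod I) I ∞ (fun z : ℝ × M => φ z.1 z.2)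
      (0, (extChartAt I p).symm (extChartAt I p p)) := by
    rw [extChartAt_to_inv]; exact h.smooth
  have h3 : ContMDiffAt 𝓘(ℝ, ℝ × EM) I ∞
      (fun w : ℝ × EM => φ w.1 ((extChartAt I p).symm w.2)) (0, extChartAt I p p) :=
    ContMDiffAt.comp (g := fun z : ℝ × M => φ z.1 z.2) (0, extChartAt I p p) h2 h1
  have h4 : ContMDiffAt I 𝓘(ℝ, EM) ∞ (extChartAt I p)
      (φ 0 ((extChartAt I p).symm (extChartAt I p p))) := by
    rw [extChartAt_to_inv, h.zero_apply]; exact contMDiffAt_extChartAt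
  exact (ContMDiffAt.comp (g := extChartAt I p) (0, extChartAt I p p) h4 h3).contDiffAt

lemma IsLocalFlow.eventually_zero_coord [IsManifold I 1 M] (h : IsLocalFlow I Z p φ) :
    ∀ᶠ z in 𝓝 (extChartAt I p p), z ∈ (extChartAt I p).target ∧
      φ 0 ((extChartAt I p).symm z) = (extChartAt I p).symm z ∧
      HasMFDerivAt 𝓘(ℝ, ℝ) I (fun s => φ s ((extChartAt I p).symm z)) 0
        ((1 : ℝ →L[ℝ] ℝ).smulRight (Z (φ 0 ((extChartAt I p).symm z)))) := by
  have hc : Filter.Tendsto (extChartAt I p).symm (𝓝 (extChartAt I p p)) (𝓝 p) := by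
    have := continuousAt_extChartAt_symm (I := I) p
    rwa [ContinuousAt, extChartAt_to_inv] at this
  have hc0 : Filter.Tendsto (fun y : M => ((0 : ℝ), y)) (𝓝 p) (𝓝 (0, p)) :=
    (Continuous.prodMk_right (0 : ℝ)).tendsto p
  filter_upwards [extChartAt_target_mem_nhds (I := I) p, hc.eventually h.zero,
    hc.eventually (hc0.eventually h.deriv)] with z h1 h2 h3
  exact ⟨h1, h2, h3⟩

lemma IsLocalFlow.hasDerivAt_flowCoord [IsManifold I 1 M] (h : IsLocalFlow I Z p φ) :
    ∀ᶠ z in 𝓝 (extChartAt I p p),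
      HasDerivAt (fun s => flowCoord I φ p (s, z)) (fieldInChart I Z p z) 0 := by
  filter_upwards [h.eventually_zero_coord] with z ⟨hz, h0, hd⟩
  have h1 : MDifferentiableAt I 𝓘(ℝ, EM) (extChartAt I p) (φ 0 ((extChartAt I p).symm z)) := by
    rw [h0]
    refine mdifferentiableAt_extChartAt ?_
    have := (extChartAt I p).map_target hz
    rwa [extChartAt_source] at this
  have h2 : ∀ v : EM, v = Z (φ 0 ((extChartAt I p).symm z)) →
      HasFDerivAt (fun s => flowCoord I φ p (s, z))
        ((dChart I p (φ 0 ((extChartAt I p).symm z))).comp ((1 : ℝ →L[ℝ] ℝ).smulRight v)) 0 := by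
    rintro v rfl
    exact (HasMFDerivAt.comp (0 : ℝ) h1.hasMFDerivAt hd).hasFDerivAt
  -- `φ 0` fixes the point only propositionally, so the base point of the fibre is generalised
  -- before being replaced.
  have h3 : ∀ y : M, y = (extChartAt I p).symm z → dChart I p y (Z y) = fieldInChart I Z p z := by
    rintro y rfl
    rfl
  refine (h2 _ rfl).hasDerivAt.congr_deriv (Eq.trans ?_ (h3 _ h0))
  exact congrArg (dChart I p (φ 0 ((extChartAt I p).symm z))) (one_smul ℝ _)

lemma IsLocalFlow.flowCoord_zero [IsManifold I 1 M] (h : IsLocalFlow I Z p φ) :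
    ∀ᶠ z in 𝓝 (extChartAt I p p), flowCoord I φ p (0, z) = z := by
  filter_upwards [h.eventually_zero_coord] with z ⟨hz, h0, _⟩
  unfold flowCoord
  rw [h0, (extChartAt I p).right_inv hz]

end FlowInChart

/-! ### The field `(0, X)` on `ℝ^k × Q` -/

section ConfigSpace

variable {k : ℕ} {E : Type*} [NormedAddCommGroup E] [NormedSpace ℝ E]
  {Q : Type*} [TopologicalSpace Q] [ChartedSpace E Q]

lemma mem_config_source {p y : (Fin k → ℝ) × Q} :
    y ∈ (extChartAt (configModel k E) p).source ↔ y.2 ∈ (extChartAt 𝓘(ℝ, E) p.2).source := by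
  rw [extChartAt_prod]
  simp
  exact fun _ => Set.mem_univ _

variable [IsManifold 𝓘(ℝ, E) ∞ Q]

lemma fieldInChart_extendField (X : Π q : Q, TangentSpace 𝓘(ℝ, E) q) {p : (Fin k → ℝ) × Q}
    {z : (Fin k → ℝ) × E} (hz : z ∈ (extChartAt (configModel k E) p).target) :
    fieldInChart (configModel k E) (extendField X) p z
      = (0, fieldInChart 𝓘(ℝ, E) X p.2 z.2) := by
  set y := (extChartAt (configModel k E) p).symm z with hy
  have hys : y ∈ (extChartAt (configModel k E) p).source :=
    (extChartAt (configModel k E) p).map_target hz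
  have hys' := mem_config_source.1 hys
  rw [extChartAt_source] at hys hys'
  have h1 := (mdifferentiableAt_extChartAt (I := configModel k E) hys).hasMFDerivAt
  have h2 : HasMFDerivAt 𝓘(ℝ, E) (configModel k E) (fun q : Q => (y.1, q)) y.2
      (mfderiv 𝓘(ℝ, E) (configModel k E) (fun q : Q => (y.1, q)) y.2) :=
    MDifferentiableAt.hasMFDerivAt (mdifferentiableAt_const.prodMk mdifferentiableAt_id)
  have h3 := HasMFDerivAt.comp (g := extChartAt (configModel k E) p) y.2 h1 h2
  have h4 := HasMFDerivAt.comp (g := fun v : E => (y.1, v)) y.2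
    (hasFDerivAt_prodMk_right (𝕜 := ℝ) y.1 (extChartAt 𝓘(ℝ, E) p.2 y.2)).hasMFDerivAt
    (mdifferentiableAt_extChartAt (I := 𝓘(ℝ, E)) hys').hasMFDerivAt
  have h5 := hasMFDerivAt_unique h3 h4
  exact DFunLike.congr_fun h5 (X y.2)

lemma smoothField_extendField {X : Π q : Q, TangentSpace 𝓘(ℝ, E) q}
    (hX : SmoothField 𝓘(ℝ, E) X) : SmoothField (configModel k E) (extendField (k := k) X) := by
  intro p
  rw [smoothFieldAt_iff _ _ (mem_extChartAt_source p)]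
  have hX' := (smoothFieldAt_iff 𝓘(ℝ, E) X (mem_extChartAt_source p.2)).1 (hX p.2)
  have h1 : ContDiffAt ℝ ∞ (fun z : (Fin k → ℝ) × E =>
      ((0 : Fin k → ℝ), fieldInChart 𝓘(ℝ, E) X p.2 z.2)) (extChartAt (configModel k E) p p) :=
    contDiffAt_const.prodMk (ContDiffAt.comp (g := fieldInChart 𝓘(ℝ, E) X p.2) (f := Prod.snd)
      (extChartAt (configModel k E) p p) hX' contDiffAt_snd)
  refine h1.congr_of_eventuallyEq ?_
  filter_upwards [extChartAt_target_mem_nhds (I := configModel k E) p] with z hz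
  exact fieldInChart_extendField X hz

omit [IsManifold 𝓘(ℝ, E) ∞ Q] in
lemma isProjectable_extendField (X : Π q : Q, TangentSpace 𝓘(ℝ, E) q) :
    IsProjectable (extendField (k := k) X) := by
  refine ⟨X, fun p => ?_⟩
  rw [mfderiv_snd]
  exact congrArg Prod.snd (extendField_eq X p)

end ConfigSpace

/-! ### Prolongations in natural coordinates -/

section Prolongation

variable {k : ℕ} {E : Type*} [NormedAddCommGroup E] [NormedSpace ℝ E]
  {Q : Type*} [TopologicalSpace Q] [ChartedSpace E Q] [IsManifold 𝓘(ℝ, E) ∞ Q]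

/-- The expression in the preferred charts at `q` of the inverse of the derivative of a map. -/
lemma inverse_comp_dChartSymm {q q' : Q} (hq' : q' ∈ (extChartAt 𝓘(ℝ, E) q).source)
    (T : E →L[ℝ] E) :
    T.inverse.comp (dChartSymm 𝓘(ℝ, E) q (extChartAt 𝓘(ℝ, E) q q'))
      = ((dChart 𝓘(ℝ, E) q q').comp T).inverse := by
  have h : dChart 𝓘(ℝ, E) q q' ∘L dChartSymm 𝓘(ℝ, E) q (extChartAt 𝓘(ℝ, E) q q')
      = ContinuousLinearMap.id ℝ E := by
    have := dChart_comp_dChartSymm 𝓘(ℝ, E) ((extChartAt 𝓘(ℝ, E) q).map_source hq')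
    rwa [(extChartAt 𝓘(ℝ, E) q).left_inv hq'] at this
  let Φ : E ≃L[ℝ] E := ContinuousLinearEquiv.equivOfInverse (dChart 𝓘(ℝ, E) q q')
    (dChartSymm 𝓘(ℝ, E) q (extChartAt 𝓘(ℝ, E) q q'))
    (dChartSymm_dChart 𝓘(ℝ, E) hq') (DFunLike.congr_fun h)
  -- Since `dChart` is an isomorphism, the identity also holds for non-invertible `T`, where both
  -- inverses are 0 by default.
  exact (ContinuousLinearMap.inverse_equiv_comp (e := Φ) (f := T)).symm

/-- The prolongation of `φ` in natural coordinates, in terms of the derivative `L` of the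
coordinate expression of `φ`. -/
lemma phase_extChartAt_prolong {φ : (Fin k → ℝ) × Q → (Fin k → ℝ) × Q} {x : PhaseSpace k E Q}
    (hmem : (φ (x.1, x.2.proj)).2 ∈ (extChartAt 𝓘(ℝ, E) x.2.proj).source)
    (hφ : MDifferentiableAt (configModel k E) (configModel k E) φ (x.1, x.2.proj))
    {L : ((Fin k → ℝ) × E) →L[ℝ] ((Fin k → ℝ) × E)}
    (hL : HasFDerivAt (fun z => extChartAt (configModel k E) (x.1, x.2.proj)
      (φ ((extChartAt (configModel k E) (x.1, x.2.proj)).symm z))) L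
      (extChartAt (configModel k E) (x.1, x.2.proj) (x.1, x.2.proj))) :
    extChartAt (phaseModel k E) x (prolong (E := E) φ x) =
      ((φ (x.1, x.2.proj)).1, extChartAt 𝓘(ℝ, E) x.2.proj (φ (x.1, x.2.proj)).2,
        (((ContinuousLinearMap.fst ℝ (Fin k → ℝ) E).comp
            (L.comp (ContinuousLinearMap.inr ℝ (Fin k → ℝ) E)))
          + (((ContinuousLinearMap.fst ℝ (Fin k → ℝ) E).comp
            (L.comp (ContinuousLinearMap.inl ℝ (Fin k → ℝ) E))).comp (momentum x))).comp
        ((ContinuousLinearMap.snd ℝ (Fin k → ℝ) E).comp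
            (L.comp (ContinuousLinearMap.inr ℝ (Fin k → ℝ) E))).inverse) := by
  set q := x.2.proj with hq
  set u := extChartAt 𝓘(ℝ, E) q q with hu
  have hz : extChartAt (configModel k E) (x.1, q) (x.1, q) = (x.1, u) := rfl
  rw [hz] at hL
  -- Restricting `L` to the two factors gives the partial derivatives in `q` and in `t` that enter
  -- `prolong`.
  have hinr := HasFDerivAt.comp (g := fun z => extChartAt (configModel k E) (x.1, q)
      (φ ((extChartAt (configModel k E) (x.1, q)).symm z))) u hL
      (hasFDerivAt_prodMk_right (𝕜 := ℝ) x.1 u)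
  have hinl := HasFDerivAt.comp (g := fun z => extChartAt (configModel k E) (x.1, q)
      (φ ((extChartAt (configModel k E) (x.1, q)).symm z))) x.1 hL
      (hasFDerivAt_prodMk_left (𝕜 := ℝ) x.1 u)
  have hdt : fderiv ℝ (fun t' => (φ (t', q)).1) x.1 = (ContinuousLinearMap.fst ℝ (Fin k → ℝ) E).comp
            (L.comp (ContinuousLinearMap.inl ℝ (Fin k → ℝ) E)) := by
    have h : (fun t' => (φ (t', q)).1) = fun t' => (φ (t', (extChartAt 𝓘(ℝ, E) q).symm u)).1 := by
      rw [hu, extChartAt_to_inv]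
    rw [h]
    exact hinl.fst.fderiv
  have hdq : (mvfderiv 𝓘(ℝ, E) (fun q' => (φ (x.1, q')).1) q : E →L[ℝ] (Fin k → ℝ))
      = (ContinuousLinearMap.fst ℝ (Fin k → ℝ) E).comp
            (L.comp (ContinuousLinearMap.inr ℝ (Fin k → ℝ) E)) := by
    refine ContinuousLinearMap.ext fun v => ?_
    refine (mvfderiv_eq_fderiv_chart 𝓘(ℝ, E) (fun q' => (φ (x.1, q')).1) q v).trans ?_
    rw [dChart_self]
    exact DFunLike.congr_fun hinr.fst.fderiv v
  let T : E →L[ℝ] E := mfderiv 𝓘(ℝ, E) 𝓘(ℝ, E) (fun q' => (φ (x.1, q')).2) q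
  have hT : (dChart 𝓘(ℝ, E) q (φ (x.1, q)).2).comp T
      = (ContinuousLinearMap.snd ℝ (Fin k → ℝ) E).comp
            (L.comp (ContinuousLinearMap.inr ℝ (Fin k → ℝ) E)) := by
    have h1 : MDifferentiableAt 𝓘(ℝ, E) (configModel k E) (fun q' : Q => φ (x.1, q')) q :=
      MDifferentiableAt.comp (g := φ) q hφ (mdifferentiableAt_const.prodMk mdifferentiableAt_id)
    have h2 : MDifferentiableAt 𝓘(ℝ, E) 𝓘(ℝ, E) (fun q' : Q => (φ (x.1, q')).2) q := h1.snd
    have hmem' := hmem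
    rw [extChartAt_source] at hmem'
    have h3 := HasMFDerivAt.comp (g := extChartAt 𝓘(ℝ, E) q) q
      (mdifferentiableAt_extChartAt (I := 𝓘(ℝ, E)) hmem').hasMFDerivAt h2.hasMFDerivAt
    refine ContinuousLinearMap.ext fun v => ?_
    refine (DFunLike.congr_fun h3.mfderiv v).symm.trans ?_
    refine (mvfderiv_eq_fderiv_chart 𝓘(ℝ, E)
      (fun q' => extChartAt 𝓘(ℝ, E) q (φ (x.1, q')).2) q v).trans ?_
    rw [dChart_self]
    exact DFunLike.congr_fun hinr.snd.fderiv v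
  refine (phase_extChartAt (x := x) (y := prolong (E := E) φ x) hmem).trans ?_
  refine Prod.ext rfl (Prod.ext rfl ?_)
  rw [← hT, ← inverse_comp_dChartSymm hmem T, ← hdt, ← hdq]
  rfl

lemma prolong_mem_source {φ : (Fin k → ℝ) × Q → (Fin k → ℝ) × Q} {x : PhaseSpace k E Q}
    (hmem : (φ (x.1, x.2.proj)).2 ∈ (extChartAt 𝓘(ℝ, E) x.2.proj).source) :
    prolong (E := E) φ x ∈ (extChartAt (phaseModel k E) x).source :=
  mem_phase_source.2 hmem

end Prolongation

/-! ### The complete lift generates the prolonged flows -/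

section CompleteLift

variable {k : ℕ} {E : Type*} [NormedAddCommGroup E] [NormedSpace ℝ E] [CompleteSpace E]
  {Q : Type*} [TopologicalSpace Q] [ChartedSpace E Q] [IsManifold 𝓘(ℝ, E) ∞ Q]
  {X : Π q : Q, TangentSpace 𝓘(ℝ, E) q}

omit [CompleteSpace E] in
lemma fderiv_fieldInChart_extendField (hX : SmoothField 𝓘(ℝ, E) X) (p : (Fin k → ℝ) × Q)
    (v : (Fin k → ℝ) × E) :
    fderiv ℝ (fieldInChart (configModel k E) (extendField X) p)
        (extChartAt (configModel k E) p p) v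
      = (0, fderiv ℝ (fieldInChart 𝓘(ℝ, E) X p.2) (extChartAt 𝓘(ℝ, E) p.2 p.2) v.2) := by
  have hX' := ((smoothFieldAt_iff 𝓘(ℝ, E) X (mem_extChartAt_source p.2)).1
    (hX p.2)).differentiableAt (by simp)
  have h1 : fieldInChart (configModel k E) (extendField X) p
      =ᶠ[𝓝 (extChartAt (configModel k E) p p)]
        fun z => ((0 : Fin k → ℝ), fieldInChart 𝓘(ℝ, E) X p.2 z.2) := by
    filter_upwards [extChartAt_target_mem_nhds (I := configModel k E) p] with z hz
    exact fieldInChart_extendField X hz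
  have h2 := (hasFDerivAt_const (0 : Fin k → ℝ) (extChartAt (configModel k E) p p)).prodMk
    (HasFDerivAt.comp (g := fieldInChart 𝓘(ℝ, E) X p.2) (extChartAt (configModel k E) p p)
      hX'.hasFDerivAt (hasFDerivAt_snd (𝕜 := ℝ)))
  rw [h1.fderiv_eq]
  exact DFunLike.congr_fun h2.fderiv v

/-- `X^{1*}` generates the prolongations of the local flows of `(0, X)`. -/
theorem isCompleteLift_completeLift (hX : SmoothField 𝓘(ℝ, E) X) :
    IsCompleteLift (k := k) (extendField X) (completeLift X) := by
  intro x φ hφ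
  set p : (Fin k → ℝ) × Q := (x.1, x.2.proj) with hp
  set z := extChartAt (configModel k E) p p with hz
  -- `L s` is the spatial derivative of the flow at `p` in coordinates. The prolongation at `x`
  -- depends on `φ s` only through its value at `p` and `L s`.
  let L : ℝ → ((Fin k → ℝ) × E) →L[ℝ] ((Fin k → ℝ) × E) :=
    fun s => fderiv ℝ (fun y => flowCoord (configModel k E) φ p (s, y)) z
  have hf := hφ.contDiffAt_flowCoord
  have hL : HasDerivAt L _ 0 := hasDerivAt_fderiv_of_hasDerivAt hf hφ.hasDerivAt_flowCoord
  have hL0 : L 0 = ContinuousLinearMap.id ℝ _ := by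
    have h : (fun y => flowCoord (configModel k E) φ p (0, y)) =ᶠ[𝓝 z] id := hφ.flowCoord_zero
    exact h.fderiv_eq.trans fderiv_id
  have hpi := hasDerivAt_prolong_coord (momentum x) hL hL0
    (fderiv_fieldInChart_extendField hX p)
  have hbase := hφ.hasDerivAt_flowCoord.self_of_nhds
  have hcs : Filter.Tendsto (fun s : ℝ => (s, p)) (𝓝 0) (𝓝 (0, p)) :=
    (Continuous.prodMk_left p).tendsto 0
  have hsmooth : ∀ᶠ s in 𝓝 (0 : ℝ), MDifferentiableAt (configModel k E) (configModel k E)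
      (φ s) p := by
    have h1 := (contMDiffAt_iff_contMDiffAt_nhds (n := 1) (by simp)).1
      (hφ.smooth.of_le (by norm_cast))
    filter_upwards [hcs.eventually h1] with s hs
    exact MDifferentiableAt.comp (g := fun w : ℝ × ((Fin k → ℝ) × Q) => φ w.1 w.2) p
      (hs.mdifferentiableAt one_ne_zero) (mdifferentiableAt_const.prodMk mdifferentiableAt_id)
  have hmem : ∀ᶠ s in 𝓝 (0 : ℝ), φ s p ∈ (extChartAt (configModel k E) p).source := by
    have h1 : Filter.Tendsto (fun s => φ s p) (𝓝 0) (𝓝 (φ 0 p)) :=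
      hφ.smooth.continuousAt.tendsto.comp hcs
    rw [hφ.zero_apply] at h1
    exact h1.eventually (extChartAt_source_mem_nhds (I := configModel k E) p)
  have hcoord : ∀ᶠ s in 𝓝 (0 : ℝ), extChartAt (phaseModel k E) x (prolong (E := E) (φ s) x) =
      ((flowCoord (configModel k E) φ p (s, z)).1, (flowCoord (configModel k E) φ p (s, z)).2,
        (((ContinuousLinearMap.fst ℝ (Fin k → ℝ) E).comp
            ((L s).comp (ContinuousLinearMap.inr ℝ (Fin k → ℝ) E)))
          + (((ContinuousLinearMap.fst ℝ (Fin k → ℝ) E).comp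
            ((L s).comp (ContinuousLinearMap.inl ℝ (Fin k → ℝ) E))).comp (momentum x))).comp
        ((ContinuousLinearMap.snd ℝ (Fin k → ℝ) E).comp
            ((L s).comp (ContinuousLinearMap.inr ℝ (Fin k → ℝ) E))).inverse) := by
    have hcz : Filter.Tendsto (fun s : ℝ => (s, z)) (𝓝 0) (𝓝 (0, z)) :=
      (Continuous.prodMk_left z).tendsto 0
    have hd := hcz.eventually ((hf.of_le (m := 1) (by norm_cast)).eventually (by simp))
    filter_upwards [hsmooth, hmem, hd] with s h1 h2 h3
    have h4 : HasFDerivAt (fun y => flowCoord (configModel k E) φ p (s, y)) (L s) z :=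
      (DifferentiableAt.comp (g := flowCoord (configModel k E) φ p) z
        (h3.differentiableAt one_ne_zero)
        (hasFDerivAt_prodMk_right (𝕜 := ℝ) s z).differentiableAt).hasFDerivAt
    refine (phase_extChartAt_prolong (φ := φ s) (x := x) (L := L s)
      (mem_config_source.1 h2) h1 h4).trans ?_
    have h5 : flowCoord (configModel k E) φ p (s, z)
        = ((φ s p).1, extChartAt 𝓘(ℝ, E) x.2.proj (φ s p).2) := by
      unfold flowCoord
      rw [hz, extChartAt_to_inv]
      rfl
    rw [h5]
  have hsource : ∀ᶠ s in 𝓝 (0 : ℝ),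
      prolong (E := E) (φ s) x ∈ (extChartAt (phaseModel k E) x).source :=
    hmem.mono fun s hs => prolong_mem_source (mem_config_source.1 hs)
  -- The identity `φ 0 = id` is known only near `p`, but this determines the value and the
  -- derivative there; comparing coordinates in the chart at `x` then suffices.
  have h0 : prolong (E := E) (φ 0) x = x := by
    refine (extChartAt (phaseModel k E) x).injOn hsource.self_of_nhds
      (mem_extChartAt_source x) ?_
    rw [hcoord.self_of_nhds, phase_extChartAt_self, hφ.flowCoord_zero.self_of_nhds, hL0]
    refine Prod.ext rfl (Prod.ext rfl ?_)
    ext v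
    simp
  refine hasMFDerivAt_curve_of_chart (phaseModel k E) (completeLift X) h0 hsource ?_
    (dChart_self_completeLift X x)
  refine HasDerivAt.congr_of_eventuallyEq ?_ hcoord
  rw [fieldInChart_extendField X (mem_extChartAt_target p)] at hbase
  have hb1 := HasFDerivAt.comp_hasDerivAt (l := Prod.fst) (0 : ℝ)
    (hasFDerivAt_fst (𝕜 := ℝ)) hbase
  have hb2 := HasFDerivAt.comp_hasDerivAt (l := Prod.snd) (0 : ℝ)
    (hasFDerivAt_snd (𝕜 := ℝ)) hbase
  exact hb1.prodMk (hb2.prodMk hpi)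

end CompleteLift

end KCosymplectic

end

/-! ### The main theorem -/

theorem mainTheorem7 {E : Type*} [NormedAddCommGroup E] [NormedSpace ℝ E] [FiniteDimensional ℝ E]
    {Q : Type*} [TopologicalSpace Q] [ChartedSpace E Q] [IsManifold 𝓘(ℝ, E) ∞ Q]
    (k : ℕ) (g : Fin k → KCosymplectic.SemiRiemannianMetric E Q)
    (V : (Fin k → ℝ) × Q → ℝ)
    (hV : ContMDiff (KCosymplectic.configModel k E) 𝓘(ℝ, ℝ) ∞ V)
    (X : Π q : Q, TangentSpace 𝓘(ℝ, E) q)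
    (hX : KCosymplectic.SmoothField 𝓘(ℝ, E) X)
    (hKilling : ∀ A : Fin k, KCosymplectic.LieDerivTwoEqZero 𝓘(ℝ, E) X (g A).val)
    (hXV : ∀ p : (Fin k → ℝ) × Q,
      mvfderiv (KCosymplectic.configModel k E) V p (KCosymplectic.extendField X p) = 0) :
    KCosymplectic.IsCompleteLift (k := k) (KCosymplectic.extendField X)
        (KCosymplectic.completeLift X) ∧
      KCosymplectic.IsNaturalInfinitesimalNoetherSymmetry
        (KCosymplectic.quadraticHamiltonian g V) (KCosymplectic.completeLift X) ∧
      KCosymplectic.IsConservationLaw (KCosymplectic.quadraticHamiltonian g V)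
        (fun x A => KCosymplectic.covector x A (X x.2.proj)) := by
  have : CompleteSpace E := FiniteDimensional.complete ℝ E
  have hH := KCosymplectic.mvfderiv_quadraticHamiltonian_completeLift hV hKilling hXV
  have hlift := KCosymplectic.isCompleteLift_completeLift (k := k) hX
  exact ⟨hlift, ⟨⟨KCosymplectic.smoothField_completeLift hX,
    fun A => KCosymplectic.lieDerivTwo_completeLift_omegaForm hX A,
    KCosymplectic.etaForm_completeLift X, hH⟩, KCosymplectic.extendField X,
    KCosymplectic.smoothField_extendField hX, KCosymplectic.isProjectable_extendField X, hlift⟩,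
    KCosymplectic.isConservationLaw_of_completeLift hX hH⟩
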